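/- Let $\Omega$ be a compact convex subset of a finite-dimensional real affine space $A$ with affine span $A$; write $n=\dim A$, and let $\mathrm{Aut}(\Omega)$ be the group of affine transformations of $A$ mapping $\Omega$ onto itself. Embed $A$ as an affine hyperplane not containing $0$ in a vector space $V$ of dimension $n+1$, let $V_+=\mathbb{R}_+\Omega$, let $V_+^*\subset V^*$ be the dual cone, and let $u\in V^*$ be the functional equal to $1$ on $A$. An *effect* is an element of $[0,u]\subset V^*$ (in the order given by $V_+^*$), and a *measurement* is a finite sequence of effects with sum $u$. A *$k$-frame* is a sequence $\omega_1,\dots,\omega_k$ of extreme points of $\Omega$ for which there is a measurement $e_1,\dots,e_k$ with $e_i(\omega_j)=\delta_{ij}$; a frame is *maximal* if it is not a subsequence of any other frame. $\Omega$ is *spectral* if every point of $\Omega$ lies in the convex hull of some frame, and *strongly symmetric* if for each $k\in\{1,\dots,n+1\}$ the group $\mathrm{Aut}(\Omega)$ acts transitively on the set of $k$-frames. The *rank* of $\Omega$ is the common cardinality of all frames that generate $\Omega$ as a face (i.e. are contained in no face of $\Omega$ other than $\Omega$ itself). A *flag* of $\Omega$ is a strictly increasing finite sequence $F_1\subsetneq\dots\subsetneq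 F_m$ of nonempty exposed faces of $\Omega$ ($\Omega$ itself counts as an exposed face); it is *maximal* if it is not a subsequence of any other flag. $\Omega$ is *regular* if $\mathrm{Aut}(\Omega)$ acts transitively on the set of maximal flags. Let $c(F)$ denote the barycenter (centroid) of a compact convex set $F$, with respect to Lebesgue measure on its affine span. For a maximal flag $\Phi=(F_1,\dots,F_m)$, regard $A$ as a vector space with origin $c(\Omega)$, let $L_\Phi$ be the linear span of $c(F_1),\dots,c(F_m)$ in it, and call $\pi_\Phi(\Omega)=L_\Phi\cap\Omega$ the *Farran–Robertson polytope* of $\Omega$ (with respect to $\Phi$). **Proposition.** Let $\Omega$ be a strongly symmetric spectral compact convex set (with affine span $A$, as above). Then $\Omega$ is regular, it has a maximal flag, and its rank $r$ is well defined (some frame generates $\Omega$, and all frames generating $\Omega$ have the same cardinality $r$). For every maximal flag $\Phi$ of $\Omega$, the Farran–Robertson polytope $\pi_\Phi(\Omega)$ is a simplex with $r$ vertices, and these vertices form a maximal frame of $\Omega$: there are affinely independent points $\omega_1,\dots,\omega_r$ such that $\pi_\Phi(\Omega)$ is the convex hull of $\{\omega_1,\dots,\omega_r\}$ and $(\omega_1,\dots,\omega_r)$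 is a maximal frame of $\Omega$. -/

import Mathlib

open Set Module MeasureTheory

noncomputable section

namespace SSS

variable {E : Type*} [NormedAddCommGroup E] [NormedSpace ℝ E]

/-- The cone `V₊ = ℝ₊ Ω` over `Ω`, in the vector space `V = E × ℝ` of one dimension more, in which
the affine space `E` is embedded as the affine hyperplane `E × {1}`. -/
def stateCone (Ω : Set E) : Set (E × ℝ) :=
  {v | ∃ t : ℝ, 0 ≤ t ∧ ∃ x ∈ Ω, v = t • (x, (1 : ℝ))}

variable (E) in
/-- The order unit `u ∈ V*`: the linear functional on `V = E × ℝ` that is `1` on `E × {1}`. -/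
def orderUnit : Dual ℝ (E × ℝ) := LinearMap.snd ℝ E ℝ

/-- An effect is an element of the order interval `[0, u]` of `V*`, ordered by the dual cone. -/
def IsEffect (Ω : Set E) (e : Dual ℝ (E × ℝ)) : Prop :=
  (∀ v ∈ stateCone Ω, 0 ≤ e v) ∧ ∀ v ∈ stateCone Ω, 0 ≤ (orderUnit E - e) v

/-- A measurement is a finite sequence of effects whose sum is the order unit. -/
def IsMeasurement (Ω : Set E) {k : ℕ} (e : Fin k → Dual ℝ (E × ℝ)) : Prop :=
  (∀ i, IsEffect Ω (e i)) ∧ ∑ i, e i = orderUnit E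

/-- The points `ω₁, …, ω_k` of `Ω` are perfectly distinguishable if some measurement satisfies
`e_i(ω_j) = δ_ij`. -/
def PerfectlyDistinguishable (Ω : Set E) {k : ℕ} (ω : Fin k → E) : Prop :=
  (∀ i, ω i ∈ Ω) ∧ ∃ e : Fin k → Dual ℝ (E × ℝ), IsMeasurement Ω e ∧
    ∀ i j, e i (ω j, 1) = if i = j then 1 else 0

/-- A `k`-frame: a sequence of `k` perfectly distinguishable extreme points. -/
def IsFrame (Ω : Set E) {k : ℕ} (ω : Fin k → E) : Prop :=
  (∀ i, ω i ∈ extremePoints ℝ Ω) ∧ PerfectlyDistinguishable Ω ω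

/-- A frame is maximal if it is not a subsequence of another frame. -/
def IsMaximalFrame (Ω : Set E) {k : ℕ} (ω : Fin k → E) : Prop :=
  IsFrame Ω ω ∧ ∀ (l : ℕ) (η : Fin l → E), IsFrame Ω η →
    (∃ s : Fin k → Fin l, StrictMono s ∧ ω = η ∘ s) → l = k

/-- `Ω` is spectral if each of its points lies in the convex hull of a frame. -/
def IsSpectral (Ω : Set E) : Prop :=
  ∀ x ∈ Ω, ∃ (k : ℕ) (ω : Fin k → E), IsFrame Ω ω ∧ x ∈ convexHull ℝ (range ω)

/-- `g ∈ Aut Ω`: the affine transformation `g` takes `Ω` onto itself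
(for `Ω` whose affine span is the whole space). -/
def IsAut (Ω : Set E) (g : E ≃ᵃ[ℝ] E) : Prop := g '' Ω = Ω

/-- `Ω`, of dimension `n`, is strongly symmetric if `Aut Ω` acts transitively on `k`-frames
for each `k ∈ {1, …, n + 1}`. -/
def IsStronglySymmetric (Ω : Set E) : Prop :=
  ∀ k : ℕ, 1 ≤ k → k ≤ finrank ℝ (vectorSpan ℝ Ω) + 1 →
    ∀ ω η : Fin k → E, IsFrame Ω ω → IsFrame Ω η →
      ∃ g : E ≃ᵃ[ℝ] E, IsAut Ω g ∧ ∀ i, g (ω i) = η i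

/-- A face of the convex set `Ω`: a convex extreme subset (`∅` and `Ω` are allowed). -/
def IsFace (Ω F : Set E) : Prop := Convex ℝ F ∧ IsExtreme ℝ Ω F

/-- The face of `Ω` generated by `S`: the smallest face of `Ω` that contains `S`. -/
def generatedFace (Ω S : Set E) : Set E := ⋂₀ {F | IsFace Ω F ∧ S ⊆ F}

/-- The face `F` of `Ω` is generated by a frame of cardinality `r`. -/
def IsGeneratedByFrame (Ω F : Set E) (r : ℕ) : Prop :=
  ∃ ω : Fin r → E, IsFrame Ω ω ∧ generatedFace Ω (range ω) = F

/-- The face `F` of `Ω` has rank `r`: some frame generates `F`, and all frames that generate `F`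
have cardinality `r`. -/
def HasRank (Ω F : Set E) (r : ℕ) : Prop := ∀ k : ℕ, IsGeneratedByFrame Ω F k ↔ k = r

/-- A flag: a strictly increasing finite sequence of nonempty exposed faces of `Ω`
(`Ω` itself is an exposed face). -/
def IsFlag (Ω : Set E) {m : ℕ} (Φ : Fin m → Set E) : Prop :=
  StrictMono Φ ∧ ∀ i, (Φ i).Nonempty ∧ IsExposed ℝ Ω (Φ i)

/-- A flag is maximal if it is not a subsequence of another flag. -/
def IsMaximalFlag (Ω : Set E) {m : ℕ} (Φ : Fin m → Set E) : Prop :=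
  IsFlag Ω Φ ∧ ∀ (l : ℕ) (Ψ : Fin l → Set E), IsFlag Ω Ψ →
    (∃ s : Fin m → Fin l, StrictMono s ∧ Φ = Ψ ∘ s) → l = m

/-- `Ω` is regular if `Aut Ω` acts transitively on the set of maximal flags. -/
def IsRegular (Ω : Set E) : Prop :=
  ∀ (m l : ℕ) (Φ : Fin m → Set E) (Ψ : Fin l → Set E), IsMaximalFlag Ω Φ → IsMaximalFlag Ω Ψ →
    ∃ (h : m = l) (g : E ≃ᵃ[ℝ] E), IsAut Ω g ∧ ∀ i, g '' Φ i = Ψ (Fin.cast h i)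

theorem affineSpan_local_eq_top {F : Set E} {p : E} (hp : p ∈ F) :
    affineSpan ℝ {v : vectorSpan ℝ F | p + (v : E) ∈ F} = ⊤ := by
  set S : Set (vectorSpan ℝ F) := {v | p + (v : E) ∈ F} with hS
  have h0 : (0 : vectorSpan ℝ F) ∈ S := by simpa [hS] using hp
  rw [AffineSubspace.affineSpan_eq_top_iff_vectorSpan_eq_top_of_nonempty ℝ _ _ ⟨0, h0⟩,
    vectorSpan_eq_span_vsub_set_right ℝ h0]
  have hS' : (fun x : vectorSpan ℝ F => x -ᵥ (0 : vectorSpan ℝ F)) '' S = S := by simp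
  rw [hS']
  refine Submodule.map_injective_of_injective (vectorSpan ℝ F).injective_subtype ?_
  rw [Submodule.map_span, Submodule.map_top, Submodule.range_subtype]
  refine Eq.trans ?_ (vectorSpan_eq_span_vsub_set_right ℝ hp).symm
  congr 1
  ext x
  constructor
  · rintro ⟨v, hv, rfl⟩
    exact ⟨p + v, hv, by simp⟩
  · rintro ⟨y, hy, rfl⟩
    exact ⟨⟨y - p, vsub_mem_vectorSpan ℝ hy hp⟩, by simpa [hS] using hy, rfl⟩

variable [FiniteDimensional ℝ E] [MeasurableSpace E] [BorelSpace E]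

/-- The mean of the points of `F` with respect to Lebesgue (Haar) measure on the affine span of
`F`, where this affine span is identified with its direction by taking `p` as the origin. -/
def meanFrom (F : Set E) (p : E) : E :=
  p + ((⨍ v in {v : vectorSpan ℝ F | p + (v : E) ∈ F}, v ∂Measure.addHaar : vectorSpan ℝ F) : E)

open Classical in
/-- The barycenter (centroid) of a nonempty compact convex set `F` (of any dimension), computed
from an arbitrary point of `F` as origin; by `barycenter_eq_meanFrom` it does not depend on that
choice. -/
def barycenter (F : Set E) : E :=
  if h : F.Nonempty then meanFrom F h.some else 0

theorem meanFrom_eq_meanFrom {F : Set E} (hF : IsCompact F) (hconv : Convex ℝ F) {p q : E}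
    (hp : p ∈ F) (hq : q ∈ F) : meanFrom F p = meanFrom F q := by
  have hc : ∀ z : E, IsCompact {v : vectorSpan ℝ F | z + (v : E) ∈ F} := fun z =>
    (((Homeomorph.addLeft z).isClosedEmbedding).comp
      (vectorSpan ℝ F).closed_of_finiteDimensional.isClosedEmbedding_subtypeVal).isCompact_preimage
        hF
  have hpos : Measure.addHaar {v : vectorSpan ℝ F | p + (v : E) ∈ F} ≠ 0 := by
    have hcv : Convex ℝ {v : vectorSpan ℝ F | p + (v : E) ∈ F} :=
      (hconv.translate_preimage_right p).is_linear_preimage (vectorSpan ℝ F).subtype.isLinear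
    have hi := hcv.interior_nonempty_iff_affineSpan_eq_top.2 (affineSpan_local_eq_top hp)
    exact (Measure.measure_pos_of_nonempty_interior _ hi).ne'
  have hfin := (hc p).measure_lt_top (μ := (Measure.addHaar : Measure (vectorSpan ℝ F))) |>.ne
  let w : vectorSpan ℝ F := ⟨q - p, vsub_mem_vectorSpan ℝ hq hp⟩
  have hpre : {v : vectorSpan ℝ F | q + (v : E) ∈ F} =
      (fun v => v + w) ⁻¹' {v : vectorSpan ℝ F | p + (v : E) ∈ F} := by
    ext v
    have : p + ((v : E) + (q - p)) = q + v := by abel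
    simp [w, this]
  have hmp := measurePreserving_add_right (Measure.addHaar : Measure (vectorSpan ℝ F)) w
  have hme : MeasurableEmbedding fun v : vectorSpan ℝ F => v + w :=
    (MeasurableEquiv.addRight w).measurableEmbedding
  have key : (⨍ v in {v : vectorSpan ℝ F | q + (v : E) ∈ F}, v ∂Measure.addHaar) =
      (⨍ v in {v : vectorSpan ℝ F | p + (v : E) ∈ F}, v ∂Measure.addHaar) - w := by
    have h1 : ∫ v in {v : vectorSpan ℝ F | q + (v : E) ∈ F}, v ∂Measure.addHaar =
        ∫ v in {v : vectorSpan ℝ F | p + (v : E) ∈ F}, (v - w) ∂Measure.addHaar := by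
      have := hmp.setIntegral_preimage_emb hme (fun v => v - w)
        {v : vectorSpan ℝ F | p + (v : E) ∈ F}
      rw [hpre, ← this]
      simp only [add_sub_cancel_right]
    have h2 : Measure.addHaar.real {v : vectorSpan ℝ F | q + (v : E) ∈ F} =
        Measure.addHaar.real {v : vectorSpan ℝ F | p + (v : E) ∈ F} := by
      rw [hpre, measureReal_def, measureReal_def,
        hmp.measure_preimage (hc p).measurableSet.nullMeasurableSet]
    have hint : IntegrableOn (fun v : vectorSpan ℝ F => v)
        {v : vectorSpan ℝ F | p + (v : E) ∈ F} Measure.addHaar :=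
      continuous_id.continuousOn.integrableOn_compact (hc p)
    have hne : Measure.addHaar.real {v : vectorSpan ℝ F | p + (v : E) ∈ F} ≠ 0 := by
      rw [measureReal_def]
      exact (ENNReal.toReal_pos hpos hfin).ne'
    rw [setAverage_eq, setAverage_eq, h1, h2,
      integral_sub hint (integrableOn_const hfin), setIntegral_const, smul_sub, smul_smul,
      inv_mul_cancel₀ hne, one_smul]
  unfold meanFrom
  rw [key]
  simp only [w, Submodule.coe_sub]
  abel

/-- The barycenter may be computed from any point of the set as origin. -/
theorem barycenter_eq_meanFrom {F : Set E} (hF : IsCompact F) (hconv : Convex ℝ F) {p : E}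
    (hp : p ∈ F) : barycenter F = meanFrom F p := by
  have h : F.Nonempty := ⟨p, hp⟩
  rw [barycenter, dif_pos h]
  exact meanFrom_eq_meanFrom hF hconv h.some_mem hp

/-- The section `L` determined by a flag `Φ` of `Ω`: the linear span of the barycenters of the
members of `Φ`, in the vector space obtained by taking the barycenter of `Ω` as the origin. -/
def farranRobertsonSection (Ω : Set E) {m : ℕ} (Φ : Fin m → Set E) : Set E :=
  {x | x - barycenter Ω ∈ Submodule.span ℝ (range fun i => barycenter (Φ i) - barycenter Ω)}

/-- The Farran–Robertson polytope `π(Ω) = L ∩ Ω` determined by a flag `Φ`. -/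
def farranRobertsonPolytope (Ω : Set E) {m : ℕ} (Φ : Fin m → Set E) : Set E :=
  farranRobertsonSection Ω Φ ∩ Ω

end SSS

end

/-! ### Barycenters and affine automorphisms -/

noncomputable section
namespace SSS

/-! Automorphisms fix the barycenter `c` and preserve the second moment of `Ω` about it, so there is
an invariant positive definite form `Q` with origin `c`. Strong symmetry on 1-frames gives all
extreme points the same square length `ρ`. The minimum of `Q (x - c) (· - c)` for extreme `x` is
attained at an extreme point that forms a 2-frame with `x`, so strong symmetry on 2-frames makes it
a constant `-b`. Adding `b` and dividing by `ρ + b` gives a positive definite form `B` on `V`,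
nonnegative on the cone, for which frames are orthonormal (`exists_frameForm`).

Since `c` is fixed, its spectral weights are equal, so it is the mean of a frame `γ` of some length
`r`, and the sum of `γ` represents the order unit (`exists_frameGeometry`). Comparing lengths of
sums for `B` shows that frames have at most `r` members and that frames with the same face have the
same sum. Each nonempty face is cut out by the sum of a frame (`exists_eq_frameFace`), and strong
symmetry holds inside faces (`exists_aut_frameFace`). Hence maximal flags are exactly the flags of
initial parts of `r`-frames, which gives regularity.

The barycenter of a frame face is the mean of its frame (`card_smul_barycenter`), so the barycenters
of a maximal flag span the affine span of an `r`-frame. There the coordinates of a point `x` are the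
numbers `B (x, 1) (ω i, 1)`; they are nonnegative on `Ω`, so the section is the simplex on the
frame. -/

/-- Change of variables with constant Jacobian. The integrand `1` shows that the Jacobian has
absolute value `1`, because `K` has finite nonzero volume and is its own image. -/
theorem setIntegral_comp_affineEquiv {E W : Type*} [NormedAddCommGroup E] [NormedSpace ℝ E]
    [FiniteDimensional ℝ E] [MeasurableSpace E] [BorelSpace E] [NormedAddCommGroup W]
    [NormedSpace ℝ W] {K : Set E} (hK : IsCompact K)
    (hK0 : (Measure.addHaar : Measure E) K ≠ 0) {g : E ≃ᵃ[ℝ] E} (hg : g '' K = K) (h : E → W) :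
    ∫ x in K, h (g x) ∂Measure.addHaar = ∫ x in K, h x ∂Measure.addHaar := by
  set L : E →L[ℝ] E := LinearMap.toContinuousLinearMap (g.linear : E →ₗ[ℝ] E) with hL
  have hd : ∀ x ∈ K, HasFDerivWithinAt g L K x := by
    intro x _
    have h1 : (g : E → E) = fun y => L y + g 0 := by
      funext y
      have := g.map_vadd 0 y
      simpa [hL] using this
    rw [h1]
    exact (L.hasFDerivAt.add_const _).hasFDerivWithinAt
  have h1 := integral_image_eq_integral_abs_det_fderiv_smul (Measure.addHaar : Measure E)
    hK.measurableSet hd g.injective.injOn fun _ => (1 : ℝ)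
  have h2 := integral_image_eq_integral_abs_det_fderiv_smul (Measure.addHaar : Measure E)
    hK.measurableSet hd g.injective.injOn h
  rw [hg, integral_smul] at h1 h2
  have hne : Measure.addHaar.real K ≠ 0 := by
    rw [measureReal_def]
    exact (ENNReal.toReal_pos hK0 hK.measure_lt_top.ne).ne'
  have hdet : |L.det| = 1 := by
    simp only [setIntegral_const, smul_eq_mul, mul_one] at h1
    exact (mul_right_cancel₀ hne ((one_mul _).trans h1)).symm
  rw [h2, hdet, one_smul]

variable {E : Type*} [NormedAddCommGroup E] [NormedSpace ℝ E]

theorem convex_local {F : Set E} (hF : Convex ℝ F) (p : E) :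
    Convex ℝ {v : vectorSpan ℝ F | p + (v : E) ∈ F} :=
  (hF.translate_preimage_right p).is_linear_preimage (vectorSpan ℝ F).subtype.isLinear

theorem isCompact_local [FiniteDimensional ℝ E] {F : Set E} (hF : IsCompact F) (p : E) :
    IsCompact {v : vectorSpan ℝ F | p + (v : E) ∈ F} :=
  (((Homeomorph.addLeft p).isClosedEmbedding).comp
    (vectorSpan ℝ F).closed_of_finiteDimensional.isClosedEmbedding_subtypeVal).isCompact_preimage hF

variable [FiniteDimensional ℝ E] [MeasurableSpace E] [BorelSpace E]

theorem addHaar_local_ne_zero {F : Set E} (hF : Convex ℝ F) {p : E} (hp : p ∈ F) :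
    (Measure.addHaar : Measure (vectorSpan ℝ F)) {v : vectorSpan ℝ F | p + (v : E) ∈ F} ≠ 0 :=
  (Measure.measure_pos_of_nonempty_interior _
    ((convex_local hF p).interior_nonempty_iff_affineSpan_eq_top.2
      (affineSpan_local_eq_top hp))).ne'

theorem barycenter_mem {F : Set E} (hF : IsCompact F) (hconv : Convex ℝ F) (hne : F.Nonempty) :
    barycenter F ∈ F := by
  obtain ⟨p, hp⟩ := hne
  rw [barycenter_eq_meanFrom hF hconv hp]
  have hc := isCompact_local hF p
  exact (convex_local hconv p).set_average_mem hc.isClosed (addHaar_local_ne_zero hconv hp)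
    hc.measure_lt_top.ne (ae_restrict_of_forall_mem hc.measurableSet fun _ h => h)
    (continuous_id.continuousOn.integrableOn_compact hc)

/-- The barycenter is fixed by each affine transformation that preserves the set. -/
theorem map_barycenter {F : Set E} (hF : IsCompact F) (hconv : Convex ℝ F) (hne : F.Nonempty)
    {g : E ≃ᵃ[ℝ] E} (hg : g '' F = F) : g (barycenter F) = barycenter F := by
  obtain ⟨p, hp⟩ := hne
  have hgp : g p ∈ F := hg ▸ mem_image_of_mem g hp
  rw [barycenter_eq_meanFrom hF hconv hp]
  have hmap : (vectorSpan ℝ F).map (g.linear : E →ₗ[ℝ] E) = vectorSpan ℝ F := by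
    have := AffineMap.map_vectorSpan (g : E →ᵃ[ℝ] E) (s := F)
    rw [show ((g : E →ᵃ[ℝ] E) : E → E) '' F = F from hg] at this
    exact this
  let L : vectorSpan ℝ F ≃ₗ[ℝ] vectorSpan ℝ F := g.linear.ofSubmodules _ _ hmap
  let w : vectorSpan ℝ F := ⟨g p - p, vsub_mem_vectorSpan ℝ hgp hp⟩
  -- This is `g` on the affine span of `F`, read in the direction space with `p` as the origin.
  let g' : vectorSpan ℝ F ≃ᵃ[ℝ] vectorSpan ℝ F :=
    L.toAffineEquiv.trans (AffineEquiv.constVAdd ℝ _ w)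
  have hg' : ∀ v : vectorSpan ℝ F, p + (g' v : E) = g (p + v) := by
    intro v
    have h1 : g ((v : E) +ᵥ p) = g.linear v +ᵥ g p := g.map_vadd p v
    have h2 : (g' v : E) = (g p - p) + g.linear v := rfl
    rw [h2, add_comm p (v : E)]
    simp only [vadd_eq_add] at h1
    rw [h1]
    abel
  have himg : g' '' {v : vectorSpan ℝ F | p + (v : E) ∈ F} =
      {v : vectorSpan ℝ F | p + (v : E) ∈ F} := by
    have hiff : ∀ v, p + (g' v : E) ∈ F ↔ p + (v : E) ∈ F := by
      intro v
      rw [hg' v]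
      exact ⟨fun h => by
        obtain ⟨y, hy, hgy⟩ := (Set.ext_iff.1 hg (g (p + v))).2 h
        exact g.injective hgy ▸ hy, fun h => (Set.ext_iff.1 hg _).1 (mem_image_of_mem g h)⟩
    ext v
    constructor
    · rintro ⟨w, hw, rfl⟩
      exact (hiff w).2 hw
    · intro hv
      refine ⟨g'.symm v, (hiff _).1 ?_, g'.apply_symm_apply v⟩
      rwa [g'.apply_symm_apply]
  set S := {v : vectorSpan ℝ F | p + (v : E) ∈ F} with hS
  have hc : IsCompact S := isCompact_local hF p
  have h0 : (Measure.addHaar : Measure (vectorSpan ℝ F)) S ≠ 0 := addHaar_local_ne_zero hconv hp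
  have hint := setIntegral_comp_affineEquiv hc h0 himg (fun v : vectorSpan ℝ F => v)
  have hne : Measure.addHaar.real S ≠ 0 := by
    rw [measureReal_def]
    exact (ENNReal.toReal_pos h0 hc.measure_lt_top.ne).ne'
  -- An affine map commutes with averaging, and composing with `g'` does not change the integral
  -- over `S`.
  have hfix : g' (⨍ v in S, v ∂Measure.addHaar) = ⨍ v in S, v ∂Measure.addHaar := by
    have hL : ∀ v, g' v = w + LinearMap.toContinuousLinearMap (L : _ →ₗ[ℝ] _) v := fun v => rfl
    have hi : IntegrableOn (fun v : vectorSpan ℝ F => v) S Measure.addHaar :=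
      continuous_id.continuousOn.integrableOn_compact hc
    have h1 : ∫ v in S, (w + LinearMap.toContinuousLinearMap (L : _ →ₗ[ℝ] _) v)
        ∂Measure.addHaar = Measure.addHaar.real S • w +
          LinearMap.toContinuousLinearMap (L : _ →ₗ[ℝ] _) (∫ v in S, v ∂Measure.addHaar) := by
      rw [← ContinuousLinearMap.integral_comp_comm _ hi, ← setIntegral_const]
      exact integral_add (integrableOn_const hc.measure_lt_top.ne)
        (ContinuousLinearMap.integrable_comp _ hi)
    simp only [hL] at hint ⊢
    rw [setAverage_eq, map_smul]
    conv_rhs => rw [← hint, h1, smul_add, smul_smul, inv_mul_cancel₀ hne, one_smul]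
  unfold meanFrom
  rw [← hg', hfix]

end SSS
end

/-! ### An invariant inner product from the second moment -/

noncomputable section
namespace SSS

variable {E : Type*} [NormedAddCommGroup E] [NormedSpace ℝ E]

theorem eq_zero_of_forall_mem_interior {Ω : Set E} (hΩ : (interior Ω).Nonempty) (c : E)
    {f : Dual ℝ E} (hf : ∀ x ∈ interior Ω, f (x - c) = 0) : f = 0 := by
  obtain ⟨x, hx⟩ := hΩ
  ext v
  have ht : Filter.Tendsto (fun t : ℝ => x + t • v) (nhdsWithin 0 {0}ᶜ) (nhds x) := by
    have : Continuous fun t : ℝ => x + t • v := by fun_prop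
    simpa using (this.tendsto 0).mono_left nhdsWithin_le_nhds
  obtain ⟨t, ht, ht0⟩ := ((ht.eventually (isOpen_interior.mem_nhds hx)).and
    self_mem_nhdsWithin).exists
  have h1 := hf _ ht
  have h2 := hf _ hx
  rw [add_sub_right_comm, map_add, h2, zero_add, map_smul, smul_eq_mul] at h1
  simpa using (mul_eq_zero.1 h1).resolve_left ht0

variable [FiniteDimensional ℝ E] [MeasurableSpace E] [BorelSpace E]

/-- The second moment of `Ω` about `c`, as a map from the dual space to the space. -/
def momentMap (Ω : Set E) (hΩ : IsCompact Ω) (c : E) : Dual ℝ E →ₗ[ℝ] E where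
  toFun f := ∫ x in Ω, f (x - c) • (x - c) ∂Measure.addHaar
  map_add' f g := by
    have hi : ∀ f : Dual ℝ E,
        IntegrableOn (fun x => f (x - c) • (x - c)) Ω Measure.addHaar := fun f => by
      have := f.continuous_of_finiteDimensional
      exact ContinuousOn.integrableOn_compact hΩ (by fun_prop)
    rw [← integral_add (hi f) (hi g)]
    simp only [LinearMap.add_apply, add_smul]
  map_smul' t f := by
    rw [RingHom.id_apply, ← integral_smul]
    simp only [LinearMap.smul_apply, smul_assoc]

theorem apply_momentMap {Ω : Set E} (hΩ : IsCompact Ω) (c : E) (f g : Dual ℝ E) :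
    g (momentMap Ω hΩ c f) = ∫ x in Ω, f (x - c) * g (x - c) ∂Measure.addHaar := by
  have hi : IntegrableOn (fun x => f (x - c) • (x - c)) Ω Measure.addHaar := by
    have := f.continuous_of_finiteDimensional
    exact ContinuousOn.integrableOn_compact hΩ (by fun_prop)
  have := (LinearMap.toContinuousLinearMap g).integral_comp_comm hi
  simpa [momentMap] using this.symm

theorem apply_momentMap_self_pos {Ω : Set E} (hΩ : IsCompact Ω) (hint : (interior Ω).Nonempty)
    (c : E) {f : Dual ℝ E} (hf : f ≠ 0) : 0 < f (momentMap Ω hΩ c f) := by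
  rw [apply_momentMap]
  have hfc := f.continuous_of_finiteDimensional
  have hcont : Continuous fun x => f (x - c) * f (x - c) := by fun_prop
  rw [setIntegral_pos_iff_support_of_nonneg_ae
    (Filter.Eventually.of_forall fun x => mul_self_nonneg _)
    (hcont.continuousOn.integrableOn_compact hΩ)]
  have hU : IsOpen ((Function.support fun x => f (x - c) * f (x - c)) ∩ interior Ω) :=
    hcont.isOpen_support.inter isOpen_interior
  refine (hU.measure_pos Measure.addHaar ?_).trans_le
    (measure_mono (inter_subset_inter_right _ interior_subset))
  by_contra hemp
  refine hf (eq_zero_of_forall_mem_interior hint c fun x hx => ?_)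
  by_contra hne
  exact hemp ⟨x, by simpa using hne, hx⟩

/-- A full-dimensional compact set with a point `c` fixed by all its automorphisms has a positive
definite symmetric form on the direction space that is invariant under the automorphisms. -/
theorem exists_invariant_form {Ω : Set E} (hΩ : IsCompact Ω) (hint : (interior Ω).Nonempty) {c : E}
    (hc : ∀ g : E ≃ᵃ[ℝ] E, IsAut Ω g → g c = c) :
    ∃ Q : E →ₗ[ℝ] E →ₗ[ℝ] ℝ, (∀ v w, Q v w = Q w v) ∧ (∀ v, v ≠ 0 → 0 < Q v v) ∧
      ∀ g : E ≃ᵃ[ℝ] E, IsAut Ω g → ∀ x y, Q (g x - c) (g y - c) = Q (x - c) (y - c) := by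
  have hinj : Function.Injective (momentMap Ω hΩ c) := by
    rw [injective_iff_map_eq_zero]
    intro f hf
    by_contra hne
    have := apply_momentMap_self_pos hΩ hint c hne
    simp [hf] at this
  -- The second moment is a form on the dual space. The required form on `E` is its inverse, `Q v w
  -- = (T⁻¹ v) w`.
  let T : Dual ℝ E ≃ₗ[ℝ] E := LinearEquiv.ofInjectiveOfFinrankEq (momentMap Ω hΩ c) hinj
    Subspace.dual_finrank_eq
  have hT : ∀ f, T f = momentMap Ω hΩ c f := fun f => rfl
  refine ⟨T.symm.toLinearMap, fun v w => ?_, fun v hv => ?_, fun g hg x y => ?_⟩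
  · obtain ⟨f, rfl⟩ := T.surjective v
    obtain ⟨f', rfl⟩ := T.surjective w
    simp only [LinearEquiv.coe_coe, LinearEquiv.symm_apply_apply]
    simp only [hT, apply_momentMap, mul_comm]
  · obtain ⟨f, rfl⟩ := T.surjective v
    simp only [LinearEquiv.coe_coe, LinearEquiv.symm_apply_apply]
    exact apply_momentMap_self_pos hΩ hint c fun h => hv (by rw [h, map_zero])
  · have hlin : ∀ z, g z - c = g.linear (z - c) := fun z => by
      have := (g : E →ᵃ[ℝ] E).linearMap_vsub z c
      simpa [hc g hg] using this.symm
    obtain ⟨f, hf⟩ := T.surjective (g x - c)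
    -- Equivariance of the moment map: the linear part of `g` carries `T (f ∘ g.linear)` to `T f`,
    -- by change of variables.
    have key : T (f ∘ₗ (g.linear : E →ₗ[ℝ] E)) = x - c := by
      apply g.linear.injective
      rw [← hlin, ← hf, hT, hT]
      have hi : IntegrableOn (fun z => f (g z - c) • (z - c)) Ω Measure.addHaar := by
        have := f.continuous_of_finiteDimensional
        have := g.continuous_of_finiteDimensional
        exact ContinuousOn.integrableOn_compact hΩ (by fun_prop)
      have h1 := (LinearMap.toContinuousLinearMap (g.linear : E →ₗ[ℝ] E)).integral_comp_comm hi
      have h0 : (Measure.addHaar : Measure E) Ω ≠ 0 :=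
        (Measure.measure_pos_of_nonempty_interior _ hint).ne'
      have h2 := setIntegral_comp_affineEquiv hΩ h0 hg fun z => f (z - c) • (z - c)
      have h3 : momentMap Ω hΩ c (f ∘ₗ (g.linear : E →ₗ[ℝ] E)) =
          ∫ z in Ω, f (g z - c) • (z - c) ∂Measure.addHaar := by
        simp only [hlin]
        rfl
      rw [h3]
      change _ = ∫ z in Ω, f (z - c) • (z - c) ∂Measure.addHaar
      rw [← h2]
      refine h1.symm.trans ?_
      simp only [map_smul, hlin]
      rfl
    rw [← hf, ← key]
    simp only [LinearEquiv.coe_coe, LinearEquiv.symm_apply_apply, hlin y]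
    rfl

end SSS
end

/-! ### Frames and the form that makes them orthonormal -/

noncomputable section
namespace SSS

variable {E : Type*} [NormedAddCommGroup E] [NormedSpace ℝ E] {Ω : Set E}

/-- The bound by the order unit is automatic: the unit minus one member is the sum of the others. -/
theorem isMeasurement_of_nonneg {k : ℕ} {e : Fin k → Dual ℝ (E × ℝ)}
    (h0 : ∀ i, ∀ x ∈ Ω, 0 ≤ e i (x, 1)) (hsum : ∑ i, e i = orderUnit E) : IsMeasurement Ω e := by
  have hcone : ∀ i, ∀ v ∈ stateCone Ω, 0 ≤ e i v := by
    rintro i _ ⟨t, ht, x, hx, rfl⟩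
    rw [map_smul]
    exact mul_nonneg ht (h0 i x hx)
  refine ⟨fun i => ⟨hcone i, fun v hv => ?_⟩, hsum⟩
  rw [← hsum, ← Finset.add_sum_erase _ _ (Finset.mem_univ i), add_sub_cancel_left,
    LinearMap.sum_apply]
  exact Finset.sum_nonneg fun j _ => hcone j v hv

theorem IsEffect.nonneg {e : Dual ℝ (E × ℝ)} (he : IsEffect Ω e) {x : E} (hx : x ∈ Ω) :
    0 ≤ e (x, 1) :=
  he.1 _ ⟨1, zero_le_one, x, hx, (one_smul _ _).symm⟩

/-- A sum below the order unit suffices: the deficit vanishes at every `ω j`, so it can be added to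
one functional without changing the values `δ_ij`. -/
theorem isFrame_of_functionals {k : ℕ} (hk : 0 < k) {ω : Fin k → E}
    (hω : ∀ i, ω i ∈ extremePoints ℝ Ω) (a : Fin k → Dual ℝ (E × ℝ))
    (h0 : ∀ i, ∀ x ∈ Ω, 0 ≤ a i (x, 1)) (h1 : ∀ x ∈ Ω, ∑ i, a i (x, 1) ≤ 1)
    (hδ : ∀ i j, a i (ω j, 1) = if i = j then 1 else 0) : IsFrame Ω ω := by
  let i₀ : Fin k := ⟨0, hk⟩
  refine ⟨hω, fun i => extremePoints_subset (hω i),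
    fun i => a i + if i = i₀ then orderUnit E - ∑ j, a j else 0,
    isMeasurement_of_nonneg (fun i x hx => ?_) ?_, fun i j => ?_⟩
  · refine add_nonneg (h0 i x hx) ?_
    split_ifs
    · have := h1 x hx
      simpa [orderUnit] using this
    · exact le_rfl
  · simp [Finset.sum_add_distrib]
  · have : (if i = i₀ then orderUnit E - ∑ j, a j else 0) (ω j, 1) = 0 := by
      split_ifs <;> simp [orderUnit, hδ]
    rw [LinearMap.add_apply, this, add_zero, hδ]

theorem IsFrame.pos {k : ℕ} {ω : Fin k → E} (h : IsFrame Ω ω) : 0 < k := by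
  obtain ⟨-, -, e, ⟨-, he⟩, -⟩ := h
  rcases Nat.eq_zero_or_pos k with rfl | hk
  · have := congrArg (fun f : Dual ℝ (E × ℝ) => f (0, 1)) he
    simp [orderUnit] at this
  · exact hk

theorem IsFrame.comp {k l : ℕ} {ω : Fin k → E} (h : IsFrame Ω ω) (hl : 0 < l) {f : Fin l → Fin k}
    (hf : Function.Injective f) : IsFrame Ω (ω ∘ f) := by
  obtain ⟨hω, -, e, ⟨he, hsum⟩, hδ⟩ := h
  refine isFrame_of_functionals hl (fun i => hω (f i)) (fun i => e (f i))
    (fun i x hx => (he _).nonneg hx) (fun x hx => ?_) fun i j => by simp [hδ, hf.eq_iff]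
  have h1 : ∑ i, e i (x, 1) = 1 := by
    rw [← LinearMap.sum_apply, hsum]
    rfl
  refine le_of_le_of_eq ?_ h1
  rw [← Finset.sum_image (s := Finset.univ) (g := f) (f := fun i => e i (x, 1)) hf.injOn]
  exact Finset.sum_le_sum_of_subset_of_nonneg (Finset.subset_univ _)
    fun i _ _ => (he i).nonneg hx

theorem isFrame_one {ω : E} (h : ω ∈ extremePoints ℝ Ω) : IsFrame Ω fun _ : Fin 1 => ω :=
  isFrame_of_functionals one_pos (fun _ => h) (fun _ => orderUnit E)
    (fun _ _ _ => zero_le_one) (fun _ _ => by simp [orderUnit])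
    fun i j => by simp [orderUnit, Subsingleton.elim i j]

theorem IsFrame.affineIndependent {k : ℕ} {ω : Fin k → E} (h : IsFrame Ω ω) :
    AffineIndependent ℝ ω := by
  obtain ⟨-, -, e, -, hδ⟩ := h
  rw [affineIndependent_iff]
  intro s w hw hs i hi
  have h1 : ∑ j ∈ s, w j • ((ω j, 1) : E × ℝ) = 0 := by
    ext
    · simpa [Prod.fst_sum] using hs
    · simpa [Prod.snd_sum] using hw
  have h2 := congrArg (e i) h1
  simp only [map_sum, map_smul, hδ, map_zero] at h2
  simpa [hi] using h2

theorem IsFrame.card_le [FiniteDimensional ℝ E] {k : ℕ} {ω : Fin k → E} (h : IsFrame Ω ω) :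
    k ≤ finrank ℝ (vectorSpan ℝ Ω) + 1 := by
  have h1 := h.affineIndependent.card_le_finrank_succ
  rw [Fintype.card_fin] at h1
  exact h1.trans (Nat.succ_le_succ (Submodule.finrank_mono (vectorSpan_mono ℝ
    (range_subset_iff.2 h.2.1))))

theorem IsStronglySymmetric.exists_aut [FiniteDimensional ℝ E] (hs : IsStronglySymmetric Ω) {k : ℕ}
    {ω η : Fin k → E} (hω : IsFrame Ω ω) (hη : IsFrame Ω η) :
    ∃ g : E ≃ᵃ[ℝ] E, IsAut Ω g ∧ ∀ i, g (ω i) = η i :=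
  hs k hω.pos hω.card_le ω η hω hη

/-- Members of weight zero are discarded. The equation in `V` records both the point and the total
weight. -/
theorem IsSpectral.exists_pos_decomposition (hs : IsSpectral Ω) {x : E} (hx : x ∈ Ω) :
    ∃ (k : ℕ) (ω : Fin k → E) (p : Fin k → ℝ), IsFrame Ω ω ∧ (∀ i, 0 < p i) ∧
      ∑ i, p i • ((ω i, 1) : E × ℝ) = (x, 1) := by
  classical
  obtain ⟨k, ω, hω, hxω⟩ := hs x hx
  rw [convexHull_range_eq_exists_affineCombination] at hxω
  obtain ⟨s, w, hw0, hw1, hwx⟩ := hxω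
  rw [Finset.affineCombination_eq_linear_combination _ _ _ hw1] at hwx
  have hsum : ∑ i ∈ s with w i ≠ 0, w i • ((ω i, 1) : E × ℝ) = (x, 1) := by
    have : ∑ i ∈ s with w i ≠ 0, w i • ((ω i, 1) : E × ℝ) = ∑ i ∈ s, w i • (ω i, 1) :=
      Finset.sum_filter_of_ne fun i _ h hi => h (by rw [hi, zero_smul])
    rw [this]
    ext
    · simpa [Prod.fst_sum] using hwx
    · simpa [Prod.snd_sum] using hw1
  set t := s.filter fun i => w i ≠ 0 with ht
  have hsum' : ∑ i : Fin t.card, w (t.equivFin.symm i) • ((ω (t.equivFin.symm i), 1) : E × ℝ) =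
      (x, 1) := by
    rw [Equiv.sum_comp t.equivFin.symm fun i : t => w i • ((ω i, 1) : E × ℝ),
      Finset.sum_coe_sort t fun i => w i • ((ω i, 1) : E × ℝ), hsum]
  refine ⟨t.card, fun i => ω (t.equivFin.symm i), fun i => w (t.equivFin.symm i),
    hω.comp (f := fun i => (t.equivFin.symm i : Fin k)) ?_
      (Subtype.val_injective.comp t.equivFin.symm.injective), fun i => ?_, hsum'⟩
  · rw [Finset.card_pos, Finset.nonempty_iff_ne_empty]
    intro h
    rw [h, Finset.sum_empty] at hsum
    simpa using congrArg Prod.snd hsum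
  · have := (t.equivFin.symm i).2
    obtain ⟨h1, h2⟩ := Finset.mem_filter.1 this
    exact (hw0 _ h1).lt_of_ne h2.symm

theorem sum_weights_eq_one {ι : Type*} [Fintype ι] {p : ι → ℝ} {ω : ι → E} {x : E}
    (h : ∑ i, p i • ((ω i, 1) : E × ℝ) = (x, 1)) : ∑ i, p i = 1 := by
  simpa [Prod.snd_sum] using congrArg Prod.snd h

/-- The value at `x` is a weighted mean of the values on a frame. This moves minima of affine
functions to extreme points. -/
theorem IsSpectral.exists_extreme_le (hs : IsSpectral Ω) (e : Dual ℝ (E × ℝ)) {x : E}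
    (hx : x ∈ Ω) : ∃ ω ∈ extremePoints ℝ Ω, e (ω, 1) ≤ e (x, 1) := by
  obtain ⟨k, ω, p, hω, hp, hpx⟩ := hs.exists_pos_decomposition hx
  by_contra! hlt
  have h1 : e (x, 1) = ∑ i, p i * e (ω i, 1) := by
    simp only [← hpx, map_sum, map_smul, smul_eq_mul]
  have h2 : ∑ i, p i * e (x, 1) < ∑ i, p i * e (ω i, 1) :=
    Finset.sum_lt_sum_of_nonempty ⟨⟨0, hω.pos⟩, Finset.mem_univ _⟩
      fun i _ => mul_lt_mul_of_pos_left (hlt _ (hω.1 i)) (hp i)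
  rw [← Finset.sum_mul, sum_weights_eq_one hpx, one_mul, ← h1] at h2
  exact lt_irrefl _ h2

/-- A positive definite symmetric form on `E × ℝ`, nonnegative on `Ω` and invariant under the
automorphisms of `Ω`, for which every frame is orthonormal. -/
structure IsFrameForm (Ω : Set E) (B : E × ℝ →ₗ[ℝ] E × ℝ →ₗ[ℝ] ℝ) : Prop where
  symm : ∀ v w, B v w = B w v
  pos : ∀ v, v ≠ 0 → 0 < B v v
  nonneg : ∀ x ∈ Ω, ∀ y ∈ Ω, 0 ≤ B (x, 1) (y, 1)
  self : ∀ x ∈ extremePoints ℝ Ω, B (x, 1) (x, 1) = 1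
  orth : ∀ (k : ℕ) (ω : Fin k → E), IsFrame Ω ω → ∀ i j, i ≠ j → B (ω i, 1) (ω j, 1) = 0
  map : ∀ g : E ≃ᵃ[ℝ] E, IsAut Ω g → ∀ x y, B (g x, 1) (g y, 1) = B (x, 1) (y, 1)

variable [FiniteDimensional ℝ E]

/-- Here `ρ` is constant because 1-frames are conjugate. For extreme `x`, a minimizer `φ` of `Q (x -
c) (· - c)` can be taken extreme, and the rescaled function then shows that `![x, φ]` is a frame.
Conjugacy of 2-frames makes the minimum independent of `x` and equal to the value at any two members
of a frame. -/
theorem exists_frame_constants (hcomp : IsCompact Ω)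
    (hspec : IsSpectral Ω) (hsymm : IsStronglySymmetric Ω) {c : E} (hcΩ : c ∈ Ω)
    {Q : E →ₗ[ℝ] E →ₗ[ℝ] ℝ} (hQs : ∀ v w, Q v w = Q w v) (hQp : ∀ v, v ≠ 0 → 0 < Q v v)
    (hQi : ∀ g : E ≃ᵃ[ℝ] E, IsAut Ω g → ∀ x y, Q (g x - c) (g y - c) = Q (x - c) (y - c)) :
    ∃ ρ b : ℝ, 0 ≤ ρ ∧ 0 < b ∧ (∀ x ∈ extremePoints ℝ Ω, Q (x - c) (x - c) = ρ) ∧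
      (∀ x ∈ Ω, ∀ y ∈ Ω, -b ≤ Q (x - c) (y - c)) ∧
      ∀ (k : ℕ) (ω : Fin k → E), IsFrame Ω ω → ∀ i j, i ≠ j →
        Q (ω i - c) (ω j - c) = -b := by
  have hQ0 : ∀ v, 0 ≤ Q v v := fun v => by
    rcases eq_or_ne v 0 with rfl | h
    · simp
    · exact (hQp v h).le
  obtain ⟨m, γ, p, hγ, hp, hpc⟩ := hspec.exists_pos_decomposition hcΩ
  let i₀ : Fin m := ⟨0, hγ.pos⟩
  set ρ := Q (γ i₀ - c) (γ i₀ - c) with hρ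
  have hpure : ∀ x ∈ extremePoints ℝ Ω, Q (x - c) (x - c) = ρ := fun x hx => by
    obtain ⟨g, hg, hgi⟩ := hsymm.exists_aut (isFrame_one (hγ.1 i₀)) (isFrame_one hx)
    rw [← hgi 0, hQi g hg]
  let e : E → Dual ℝ (E × ℝ) := fun x =>
    Q (x - c) ∘ₗ (LinearMap.fst ℝ E ℝ - (LinearMap.snd ℝ E ℝ).smulRight c)
  have he : ∀ x y, e x (y, 1) = Q (x - c) (y - c) := fun x y => by simp [e]
  -- If `ρ = 0`, then `Ω` is the point `c`, no frame has two members, and any positive `b` serves.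
  rcases (hQ0 (γ i₀ - c)).eq_or_lt with h0 | hρ0
  · have hpc' : ∀ x ∈ extremePoints ℝ Ω, x = c := fun x hx => by
      by_contra hne
      have := hQp (x - c) (sub_ne_zero.2 hne)
      rw [hpure x hx, hρ, ← h0] at this
      exact lt_irrefl _ this
    have hΩc : ∀ x ∈ Ω, x = c := fun x hx => by
      obtain ⟨k, ω, q, hω, hq, hqx⟩ := hspec.exists_pos_decomposition hx
      simp_rw [fun i => hpc' _ (hω.1 i)] at hqx
      have h1 := sum_weights_eq_one (ω := fun _ => c) hqx
      rw [← Finset.sum_smul, h1, one_smul] at hqx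
      exact (congrArg Prod.fst hqx).symm
    refine ⟨ρ, 1, hQ0 _, one_pos, hpure, fun x hx y hy => by simp [hΩc x hx], ?_⟩
    intro k ω hω i j hij
    obtain ⟨hext, -, f, -, hδ⟩ := hω
    have h1 := hδ i i
    have h2 := hδ i j
    rw [hpc' _ (hext i)] at h1
    rw [hpc' _ (hext j), h1] at h2
    simp [hij] at h2
  have hle : ∀ x ∈ extremePoints ℝ Ω, ∀ y ∈ Ω, Q (x - c) (y - c) ≤ ρ := fun x hx y hy => by
    obtain ⟨ω, hω, h1⟩ := hspec.exists_extreme_le (-e x) hy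
    simp only [LinearMap.neg_apply, he] at h1
    -- Two vectors of square length `ρ` have product at most `ρ`, since the square of their
    -- difference is nonnegative.
    have h2 := hQ0 ((x - c) - (ω - c))
    simp only [map_sub, LinearMap.sub_apply] at h2 h1 ⊢
    have h3 := hpure x hx
    have h4 := hpure ω hω
    have h5 := hQs x ω
    have h6 := hQs x c
    have h7 := hQs ω c
    simp only [map_sub, LinearMap.sub_apply] at h3 h4
    linarith
  have hmin : ∀ x ∈ extremePoints ℝ Ω, ∃ φ ∈ Ω, (∀ y ∈ Ω, Q (x - c) (φ - c) ≤ Q (x - c) (y - c)) ∧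
      IsFrame Ω ![x, φ] := fun x hx => by
    have hcont : ContinuousOn (fun y => Q (x - c) (y - c)) Ω := by
      have := (Q (x - c)).continuous_of_finiteDimensional
      fun_prop
    obtain ⟨y₀, hy₀, hmin⟩ := hcomp.exists_isMinOn ⟨c, hcΩ⟩ hcont
    obtain ⟨φ, hφ, hφy⟩ := hspec.exists_extreme_le (e x) hy₀
    rw [he, he] at hφy
    have hφmin : ∀ y ∈ Ω, Q (x - c) (φ - c) ≤ Q (x - c) (y - c) :=
      fun y hy => hφy.trans (hmin hy)
    refine ⟨φ, extremePoints_subset hφ, hφmin, ?_⟩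
    -- Inside this step `b` is the minimum itself, hence at most `0`; the constant in the conclusion
    -- has the opposite sign.
    set b := Q (x - c) (φ - c) with hb
    have hb0 : b ≤ 0 := by simpa using hφmin c hcΩ
    have hd : 0 < ρ - b := by linarith
    let a : Dual ℝ (E × ℝ) := (ρ - b)⁻¹ • (e x - b • orderUnit E)
    have ha : ∀ y, a (y, 1) = (Q (x - c) (y - c) - b) / (ρ - b) := fun y => by
      simp [a, orderUnit, he, div_eq_inv_mul]
    have ha1 : a (x, 1) = 1 := by rw [ha, hpure x hx, div_self hd.ne']
    have ha0 : a (φ, 1) = 0 := by rw [ha, ← hb, sub_self, zero_div]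
    refine isFrame_of_functionals two_pos (fun i => ?_) ![a, orderUnit E - a] (fun i y hy => ?_)
      (fun y hy => ?_) fun i j => ?_
    · fin_cases i
      · exact hx
      · exact hφ
    · fin_cases i
      · simp only [Fin.zero_eta, Matrix.cons_val_zero, ha]
        exact div_nonneg (sub_nonneg.2 (hφmin y hy)) hd.le
      · simp only [Fin.mk_one, Matrix.cons_val_one, Matrix.cons_val_zero, LinearMap.sub_apply, ha,
          orderUnit, LinearMap.snd_apply, sub_nonneg]
        rw [div_le_one hd]
        linarith [hle x hx y hy]
    · simp [orderUnit]
    · fin_cases i <;> fin_cases j <;> simp [ha1, ha0, orderUnit]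
  -- This makes `b` positive. The weighted mean of the `γ i - c` is zero, so its product with `γ i₀
  -- - c` is zero, while the term at `i₀` is positive.
  have hneg : ∃ x ∈ extremePoints ℝ Ω, ∃ y ∈ Ω, Q (x - c) (y - c) < 0 := by
    by_contra! hall
    have h1 : e (γ i₀) (c, 1) = ∑ i, p i * e (γ i₀) (γ i, 1) := by
      simp only [← hpc, map_sum, map_smul, smul_eq_mul]
    simp only [he, sub_self, map_zero] at h1
    have h2 : 0 < ∑ i, p i * Q (γ i₀ - c) (γ i - c) :=
      Finset.sum_pos' (fun i _ => mul_nonneg (hp i).le (hall _ (hγ.1 i₀) _ (hγ.2.1 i)))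
        ⟨i₀, Finset.mem_univ _, mul_pos (hp i₀) hρ0⟩
    exact h2.ne h1
  obtain ⟨x₁, hx₁, y₁, hy₁, hxy⟩ := hneg
  obtain ⟨φ₁, hφ₁, hmin₁, hf₁⟩ := hmin x₁ hx₁
  have hpair : ∀ ω : Fin 2 → E, IsFrame Ω ω → Q (ω 0 - c) (ω 1 - c) = Q (x₁ - c) (φ₁ - c) :=
    fun ω hω => by
      obtain ⟨g, hg, hgi⟩ := hsymm.exists_aut hf₁ hω
      rw [← hgi 0, ← hgi 1, hQi g hg]
      rfl
  refine ⟨ρ, -Q (x₁ - c) (φ₁ - c), hρ0.le, ?_, hpure, fun x hx y hy => ?_,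
    fun k ω hω i j hij => ?_⟩
  · linarith [hmin₁ y₁ hy₁]
  · rw [neg_neg]
    obtain ⟨ω, hω, hωx⟩ := hspec.exists_extreme_le (e y) hx
    obtain ⟨φ, -, h1, h2⟩ := hmin ω hω
    rw [he, he, hQs _ (ω - c), hQs _ (x - c)] at hωx
    exact ((hpair _ h2).symm.trans_le (h1 y hy)).trans hωx
  · rw [neg_neg]
    refine hpair (ω ∘ ![i, j]) (hω.comp two_pos ?_)
    intro a b hab
    fin_cases a <;> fin_cases b <;> simp_all

theorem exists_frameForm (hcomp : IsCompact Ω) (hspec : IsSpectral Ω)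
    (hsymm : IsStronglySymmetric Ω) {c : E} (hcΩ : c ∈ Ω)
    {Q : E →ₗ[ℝ] E →ₗ[ℝ] ℝ} (hQs : ∀ v w, Q v w = Q w v) (hQp : ∀ v, v ≠ 0 → 0 < Q v v)
    (hQi : ∀ g : E ≃ᵃ[ℝ] E, IsAut Ω g → ∀ x y, Q (g x - c) (g y - c) = Q (x - c) (y - c)) :
    ∃ B, IsFrameForm Ω B := by
  obtain ⟨ρ, b, hρ, hb, hpure, hge, hpair⟩ :=
    exists_frame_constants hcomp hspec hsymm hcΩ hQs hQp hQi
  have hd : 0 < ρ + b := by linarith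
  let P : E × ℝ →ₗ[ℝ] E := LinearMap.fst ℝ E ℝ - (LinearMap.snd ℝ E ℝ).smulRight c
  let B : E × ℝ →ₗ[ℝ] E × ℝ →ₗ[ℝ] ℝ := (ρ + b)⁻¹ • (Q.compl₁₂ P P +
    b • (LinearMap.mul ℝ ℝ).compl₁₂ (LinearMap.snd ℝ E ℝ) (LinearMap.snd ℝ E ℝ))
  have hB : ∀ v w, B v w = (ρ + b)⁻¹ * (Q (v.1 - v.2 • c) (w.1 - w.2 • c) + b * (v.2 * w.2)) :=
    fun v w => rfl
  have hB1 : ∀ x y : E, B (x, 1) (y, 1) = (ρ + b)⁻¹ * (Q (x - c) (y - c) + b) := fun x y => by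
    rw [hB]
    simp
  refine ⟨B, fun v w => ?_, fun v hv => ?_, fun x hx y hy => ?_, fun x hx => ?_,
    fun k ω hω i j hij => ?_, fun g hg x y => ?_⟩
  · rw [hB, hB, hQs, mul_comm v.2]
  · rw [hB]
    refine mul_pos (inv_pos.2 hd) ?_
    rcases eq_or_ne v.2 0 with h2 | h2
    · have h1 : v.1 ≠ 0 := fun h1 => hv (Prod.ext h1 h2)
      simpa [h2] using hQp _ h1
    · have : 0 ≤ Q (v.1 - v.2 • c) (v.1 - v.2 • c) := by
        rcases eq_or_ne (v.1 - v.2 • c) 0 with h | h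
        · simp [h]
        · exact (hQp _ h).le
      have := mul_pos hb (mul_self_pos.2 h2)
      linarith
  · rw [hB1]
    exact mul_nonneg (inv_nonneg.2 hd.le) (by linarith [hge x hx y hy])
  · rw [hB1, hpure x hx, inv_mul_cancel₀ hd.ne']
  · rw [hB1, hpair k ω hω i j hij]
    simp
  · rw [hB1, hB1, hQi g hg]

end SSS
end

/-! ### Orthonormal families and a frame that sums to the order unit -/

noncomputable section
namespace SSS

variable {E : Type*} [NormedAddCommGroup E] [NormedSpace ℝ E] {Ω : Set E}
  {B : E × ℝ →ₗ[ℝ] E × ℝ →ₗ[ℝ] ℝ} {ι κ : Type*} [Fintype ι] [Fintype κ]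

/-- The sum, in `V = E × ℝ`, of a finite family of points of `E`. -/
def frameSum (ω : ι → E) : E × ℝ := ∑ i, (ω i, 1)

/-- The points of `Ω` at which the effect represented by the sum of `ω` takes the value `1`. -/
def frameFace (Ω : Set E) (B : E × ℝ →ₗ[ℝ] E × ℝ →ₗ[ℝ] ℝ) (ω : ι → E) : Set E :=
  {x ∈ Ω | B (frameSum ω) (x, 1) = 1}

/-- A finite family of extreme points that is orthonormal for `B` and whose sum is at most the
order unit. -/
structure IsOrthoFrame (Ω : Set E) (B : E × ℝ →ₗ[ℝ] E × ℝ →ₗ[ℝ] ℝ) (ω : ι → E) : Prop where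
  extreme : ∀ i, ω i ∈ extremePoints ℝ Ω
  orth : ∀ i j, i ≠ j → B (ω i, 1) (ω j, 1) = 0
  le_one : ∀ x ∈ Ω, B (frameSum ω) (x, 1) ≤ 1

theorem frameSum_apply (ω : ι → E) (v : E × ℝ) : B (frameSum ω) v = ∑ i, B (ω i, 1) v := by
  simp [frameSum, LinearMap.sum_apply]

theorem apply_frameSum (ω : ι → E) (v : E × ℝ) : B v (frameSum ω) = ∑ i, B v (ω i, 1) := by
  simp [frameSum]

theorem frameSum_sumElim {E : Type*} [NormedAddCommGroup E] (ω : ι → E) (η : κ → E) :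
    frameSum (Sum.elim ω η) = frameSum ω + frameSum η := by
  simp [frameSum, Fintype.sum_sum_type]

theorem IsFrameForm.frameSum_apply_self (hB : IsFrameForm Ω B) {ω : ι → E}
    (hext : ∀ i, ω i ∈ extremePoints ℝ Ω) (horth : ∀ i j, i ≠ j → B (ω i, 1) (ω j, 1) = 0) (j : ι) :
    B (frameSum ω) (ω j, 1) = 1 := by
  rw [frameSum_apply, Finset.sum_eq_single j (fun i _ hij => horth i j hij) (by simp),
    hB.self _ (hext j)]

theorem frameSum_apply_frameSum {ω : ι → E} {η : κ → E}
    (h : ∀ j, B (frameSum ω) (η j, 1) = 1) : B (frameSum ω) (frameSum η) = Fintype.card κ := by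
  simp [apply_frameSum, h]

/-- An orthonormal family on which the sum of another one takes the value `1` is not larger, and it
has the same sum if it is equally large. -/
theorem IsFrameForm.card_le_of_apply_eq_one (hB : IsFrameForm Ω B) {ω : ι → E} {η : κ → E}
    (hω : ∀ i, ω i ∈ extremePoints ℝ Ω) (hω' : ∀ i j, i ≠ j → B (ω i, 1) (ω j, 1) = 0)
    (hη : ∀ i, η i ∈ extremePoints ℝ Ω) (hη' : ∀ i j, i ≠ j → B (η i, 1) (η j, 1) = 0)
    (h : ∀ j, B (frameSum ω) (η j, 1) = 1) :
    Fintype.card κ ≤ Fintype.card ι ∧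
      (Fintype.card κ = Fintype.card ι → frameSum η = frameSum ω) := by
  have h1 := frameSum_apply_frameSum h
  have h2 := frameSum_apply_frameSum (hB.frameSum_apply_self hω hω')
  have h3 := frameSum_apply_frameSum (hB.frameSum_apply_self hη hη')
  -- The square length of the difference of the sums is the difference of the cardinalities; both
  -- claims follow from positive definiteness.
  have h4 : B (frameSum ω - frameSum η) (frameSum ω - frameSum η) =
      Fintype.card ι - Fintype.card κ := by
    simp only [map_sub, LinearMap.sub_apply, h1, h2, h3, hB.symm (frameSum η)]
    ring
  constructor
  · have h5 : 0 ≤ B (frameSum ω - frameSum η) (frameSum ω - frameSum η) := by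
      rcases eq_or_ne (frameSum ω - frameSum η) 0 with h | h
      · simp [h]
      · exact (hB.pos _ h).le
    rw [h4, sub_nonneg] at h5
    exact_mod_cast h5
  · intro heq
    by_contra hne
    have := hB.pos _ (sub_ne_zero.2 (Ne.symm hne))
    rw [h4, heq, sub_self] at this
    exact lt_irrefl _ this

theorem IsAut.mem_iff {g : E ≃ᵃ[ℝ] E} (hg : IsAut Ω g) {x : E} : g x ∈ Ω ↔ x ∈ Ω := by
  conv_lhs => rw [← show g '' Ω = Ω from hg]
  exact g.injective.mem_set_image

theorem IsAut.symm {g : E ≃ᵃ[ℝ] E} (hg : IsAut Ω g) : IsAut Ω g.symm := by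
  have h : g '' Ω = Ω := hg
  change g.symm '' Ω = Ω
  conv_lhs => rw [← h]
  rw [image_image]
  simp

theorem isAut_refl : IsAut Ω (AffineEquiv.refl ℝ E) := by
  simp [IsAut]

theorem IsAut.map_extremePoints {g : E ≃ᵃ[ℝ] E} (hg : IsAut Ω g) {x : E}
    (hx : x ∈ extremePoints ℝ Ω) : g x ∈ extremePoints ℝ Ω := by
  rw [mem_extremePoints_iff_left] at hx ⊢
  refine ⟨hg.mem_iff.2 hx.1, fun y hy z hz hxyz => ?_⟩
  have h1 : x ∈ openSegment ℝ (g.symm y) (g.symm z) := by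
    have := mem_image_of_mem (g.symm : E →ᵃ[ℝ] E) hxyz
    rw [image_openSegment] at this
    simpa using this
  rw [← hx.2 _ (hg.symm.mem_iff.2 hy) _ (hg.symm.mem_iff.2 hz) h1, g.apply_symm_apply]

theorem IsFrameForm.frameSum_map (hB : IsFrameForm Ω B) {g : E ≃ᵃ[ℝ] E} (hg : IsAut Ω g)
    (ω : ι → E) (x : E) : B (frameSum (g ∘ ω)) (g x, 1) = B (frameSum ω) (x, 1) := by
  simp only [frameSum_apply, Function.comp_apply, hB.map g hg]

theorem IsOrthoFrame.map (hB : IsFrameForm Ω B) {ω : ι → E} (hω : IsOrthoFrame Ω B ω)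
    {g : E ≃ᵃ[ℝ] E} (hg : IsAut Ω g) : IsOrthoFrame Ω B (g ∘ ω) := by
  refine ⟨fun i => hg.map_extremePoints (hω.extreme i), fun i j hij => ?_, fun x hx => ?_⟩
  · rw [Function.comp_apply, Function.comp_apply, hB.map g hg, hω.orth i j hij]
  · rw [← g.apply_symm_apply x, hB.frameSum_map hg]
    exact hω.le_one _ (hg.symm.mem_iff.2 hx)

theorem IsFrameForm.image_frameFace (hB : IsFrameForm Ω B) {g : E ≃ᵃ[ℝ] E} (hg : IsAut Ω g)
    (ω : ι → E) : g '' frameFace Ω B ω = frameFace Ω B (g ∘ ω) := by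
  ext x
  constructor
  · rintro ⟨y, ⟨hy, hy1⟩, rfl⟩
    exact ⟨hg.mem_iff.2 hy, by rw [hB.frameSum_map hg, hy1]⟩
  · rintro ⟨hx, hx1⟩
    refine ⟨g.symm x, ⟨hg.symm.mem_iff.2 hx, ?_⟩, g.apply_symm_apply x⟩
    rw [← hB.frameSum_map hg, g.apply_symm_apply, hx1]

theorem IsOrthoFrame.mem (hB : IsFrameForm Ω B) {ω : ι → E} (hω : IsOrthoFrame Ω B ω) (i : ι) :
    ω i ∈ frameFace Ω B ω :=
  ⟨extremePoints_subset (hω.extreme i), hB.frameSum_apply_self hω.extreme hω.orth i⟩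

theorem IsOrthoFrame.frameSum_comp_le (hB : IsFrameForm Ω B) {ω : ι → E}
    (hω : IsOrthoFrame Ω B ω) {f : κ → ι} (hf : Function.Injective f) {x : E} (hx : x ∈ Ω) :
    B (frameSum (ω ∘ f)) (x, 1) ≤ B (frameSum ω) (x, 1) := by
  classical
  rw [frameSum_apply, frameSum_apply]
  simp only [Function.comp_apply]
  rw [← Finset.sum_image (s := Finset.univ) (g := f) (f := fun i => B (ω i, 1) (x, 1)) hf.injOn]
  exact Finset.sum_le_sum_of_subset_of_nonneg (Finset.subset_univ _)
    fun i _ _ => hB.nonneg _ (extremePoints_subset (hω.extreme i)) _ hx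

theorem IsOrthoFrame.comp (hB : IsFrameForm Ω B) {ω : ι → E} (hω : IsOrthoFrame Ω B ω) {f : κ → ι}
    (hf : Function.Injective f) : IsOrthoFrame Ω B (ω ∘ f) :=
  ⟨fun _ => hω.extreme _, fun _ _ hij => hω.orth _ _ (hf.ne hij),
    fun x hx => (hω.frameSum_comp_le hB hf hx).trans (hω.le_one x hx)⟩

theorem IsOrthoFrame.isFrame (hB : IsFrameForm Ω B) {k : ℕ} {ω : Fin k → E}
    (hω : IsOrthoFrame Ω B ω) (hk : 0 < k) : IsFrame Ω ω := by
  refine isFrame_of_functionals hk hω.extreme (fun i => B (ω i, 1))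
    (fun i x hx => hB.nonneg _ (extremePoints_subset (hω.extreme i)) _ hx)
    (fun x hx => ?_) fun i j => ?_
  · rw [← frameSum_apply]
    exact hω.le_one x hx
  · split_ifs with h
    · rw [h, hB.self _ (hω.extreme j)]
    · exact hω.orth i j h

/-- A strongly symmetric spectral convex set, with a frame form `B` and a frame `γ` whose sum
represents the order unit. -/
structure FrameGeometry (Ω : Set E) (B : E × ℝ →ₗ[ℝ] E × ℝ →ₗ[ℝ] ℝ) {r : ℕ} (γ : Fin r → E) :
    Prop where
  convex : Convex ℝ Ω
  form : IsFrameForm Ω B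
  spectral : IsSpectral Ω
  symmetric : IsStronglySymmetric Ω
  frame : IsFrame Ω γ
  unit : ∀ x ∈ Ω, B (frameSum γ) (x, 1) = 1

namespace FrameGeometry

variable {r : ℕ} {γ : Fin r → E}

theorem isOrthoFrame_unit (H : FrameGeometry Ω B γ) : IsOrthoFrame Ω B γ :=
  ⟨H.frame.1, H.form.orth r γ H.frame, fun x hx => (H.unit x hx).le⟩

theorem card_le (H : FrameGeometry Ω B γ) {ω : ι → E} (hω : IsOrthoFrame Ω B ω) :
    Fintype.card ι ≤ r := by
  simpa using (H.form.card_le_of_apply_eq_one H.frame.1 (H.form.orth r γ H.frame) hω.extreme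
    hω.orth fun j => H.unit _ (extremePoints_subset (hω.extreme j))).1

theorem frameSum_apply_of_card (H : FrameGeometry Ω B γ) {ω : ι → E} (hω : IsOrthoFrame Ω B ω)
    (hcard : Fintype.card ι = r) : frameSum ω = frameSum γ :=
  (H.form.card_le_of_apply_eq_one H.frame.1 (H.form.orth r γ H.frame) hω.extreme
    hω.orth fun j => H.unit _ (extremePoints_subset (hω.extreme j))).2
      (hcard.trans (Fintype.card_fin r).symm)

end FrameGeometry

variable [FiniteDimensional ℝ E]

/-- As `c` is fixed and extreme points are conjugate, `B (c, 1)` is constant on extreme points,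
hence on `Ω`. The weights of a frame decomposition of `c` are values of this constant, so the frame
sum is a multiple of `(c, 1)`. -/
theorem exists_frameGeometry (hconv : Convex ℝ Ω) (hB : IsFrameForm Ω B) (hspec : IsSpectral Ω)
    (hsymm : IsStronglySymmetric Ω) {c : E} (hc : c ∈ Ω)
    (hfix : ∀ g : E ≃ᵃ[ℝ] E, IsAut Ω g → g c = c) :
    ∃ (r : ℕ) (γ : Fin r → E), FrameGeometry Ω B γ := by
  obtain ⟨r, γ, p, hγ, hp, hpc⟩ := hspec.exists_pos_decomposition hc
  let i₀ : Fin r := ⟨0, hγ.pos⟩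
  have hconst : ∀ x ∈ extremePoints ℝ Ω, B (c, 1) (x, 1) = p i₀ := fun x hx => by
    obtain ⟨g, hg, hgx⟩ := hsymm.exists_aut (isFrame_one (hγ.1 i₀)) (isFrame_one hx)
    have h1 := hB.map g hg c (γ i₀)
    rw [hfix g hg, hgx 0] at h1
    rw [h1, ← hpc]
    simp only [map_sum, map_smul, LinearMap.sum_apply, LinearMap.smul_apply, smul_eq_mul]
    rw [Finset.sum_eq_single i₀ (fun i _ hi => by rw [hB.orth r γ hγ i i₀ hi, mul_zero]) (by simp),
      hB.self _ (hγ.1 i₀), mul_one]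
  have hp' : ∀ i, p i = p i₀ := fun i => by
    rw [← hconst _ (hγ.1 i), ← hpc]
    simp only [map_sum, map_smul, LinearMap.sum_apply, LinearMap.smul_apply, smul_eq_mul]
    rw [Finset.sum_eq_single i (fun j _ hj => by rw [hB.orth r γ hγ j i hj, mul_zero]) (by simp),
      hB.self _ (hγ.1 i), mul_one]
  have hc' : p i₀ • frameSum γ = (c, 1) := by
    rw [← hpc, frameSum, Finset.smul_sum]
    exact Finset.sum_congr rfl fun i _ => by rw [hp' i]
  refine ⟨r, γ, hconv, hB, hspec, hsymm, hγ, fun x hx => ?_⟩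
  obtain ⟨k, ω, q, hω, -, hqx⟩ := hspec.exists_pos_decomposition hx
  have h1 : B (c, 1) (x, 1) = p i₀ := by
    rw [← hqx]
    simp only [map_sum, map_smul, smul_eq_mul, hconst _ (hω.1 _)]
    rw [← Finset.sum_mul, sum_weights_eq_one hqx, one_mul]
  rw [← hc', map_smul, LinearMap.smul_apply, smul_eq_mul] at h1
  exact mul_left_cancel₀ (hp i₀).ne' (h1.trans (mul_one _).symm)

namespace FrameGeometry

variable {r : ℕ} {γ : Fin r → E}

/-- The definition of a frame allows arbitrary effects; this shows that the functionals `B (ω i, 1)`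
themselves have sum at most the unit. Orthogonality bounds the length by `r`, and then the frame is
conjugate to an initial part of `γ`. -/
theorem isOrthoFrame (H : FrameGeometry Ω B γ) {k : ℕ} {ω : Fin k → E} (hω : IsFrame Ω ω) :
    IsOrthoFrame Ω B ω := by
  have horth := H.form.orth k ω hω
  have hle := (H.form.card_le_of_apply_eq_one H.frame.1 (H.form.orth r γ H.frame) hω.1 horth
    fun j => H.unit _ (hω.2.1 j)).1
  rw [Fintype.card_fin, Fintype.card_fin] at hle
  obtain ⟨g, hg, hgω⟩ := H.symmetric.exists_aut
    (H.frame.comp hω.pos (Fin.castLE_injective hle)) hω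
  have h := (H.isOrthoFrame_unit.map H.form hg).comp H.form (Fin.castLE_injective hle)
  rwa [show (g ∘ γ) ∘ Fin.castLE hle = ω from funext hgω] at h

theorem exists_aut (H : FrameGeometry Ω B γ) {ω η : ι → E} (hω : IsOrthoFrame Ω B ω)
    (hη : IsOrthoFrame Ω B η) : ∃ g : E ≃ᵃ[ℝ] E, IsAut Ω g ∧ ∀ i, g (ω i) = η i := by
  rcases isEmpty_or_nonempty ι with h | h
  · exact ⟨AffineEquiv.refl ℝ E, isAut_refl, fun i => (h.false i).elim⟩
  · let e := (Fintype.equivFin ι).symm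
    obtain ⟨g, hg, hgω⟩ := H.symmetric.exists_aut
      ((hω.comp H.form e.injective).isFrame H.form Fintype.card_pos)
      ((hη.comp H.form e.injective).isFrame H.form Fintype.card_pos)
    exact ⟨g, hg, fun i => by simpa using hgω (e.symm i)⟩

/-- Each orthogonal frame has a complement. -/
theorem exists_complement (H : FrameGeometry Ω B γ) {ω : ι → E} (hω : IsOrthoFrame Ω B ω) :
    ∃ (m : ℕ) (ω' : Fin m → E), IsOrthoFrame Ω B (Sum.elim ω ω') ∧ Fintype.card ι + m = r ∧
      ∀ x ∈ Ω, B (frameSum ω) (x, 1) + B (frameSum ω') (x, 1) = 1 := by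
  have hle := H.card_le hω
  obtain ⟨e⟩ : Nonempty (ι ⊕ Fin (r - Fintype.card ι) ≃ Fin r) :=
    Fintype.card_eq.1 (by simp [hle])
  -- An automorphism carries part of `γ` to `ω`; the image of the rest of `γ` is the complement.
  obtain ⟨g, hg, hgω⟩ := H.exists_aut
    (H.isOrthoFrame_unit.comp H.form (e.injective.comp Sum.inl_injective)) hω
  have heq : Sum.elim ω (fun i => g (γ (e (Sum.inr i)))) = (g ∘ γ) ∘ e := by
    funext i
    rcases i with i | i
    · exact (hgω i).symm
    · rfl
  have hf : IsOrthoFrame Ω B (Sum.elim ω fun i => g (γ (e (Sum.inr i)))) := by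
    rw [heq]
    exact (H.isOrthoFrame_unit.map H.form hg).comp H.form e.injective
  refine ⟨r - Fintype.card ι, fun i => g (γ (e (Sum.inr i))), hf, by omega, fun x hx => ?_⟩
  rw [← LinearMap.add_apply, ← map_add, ← frameSum_sumElim,
    H.frameSum_apply_of_card hf (by simp [hle]), H.unit x hx]

end FrameGeometry
end SSS
end

/-! ### Cones over faces, and faces as frame faces -/

noncomputable section
namespace SSS

variable {E : Type*} [NormedAddCommGroup E] [NormedSpace ℝ E] {Ω F : Set E}
  {B : E × ℝ →ₗ[ℝ] E × ℝ →ₗ[ℝ] ℝ} {ι κ : Type*} [Fintype ι] [Fintype κ]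

theorem mem_stateCone {x : E} (hx : x ∈ F) : ((x, 1) : E × ℝ) ∈ stateCone F :=
  ⟨1, zero_le_one, x, hx, (one_smul _ _).symm⟩

theorem smul_mem_stateCone {v : E × ℝ} (hv : v ∈ stateCone F) {t : ℝ} (ht : 0 ≤ t) :
    t • v ∈ stateCone F := by
  obtain ⟨s, hs, x, hx, rfl⟩ := hv
  exact ⟨t * s, mul_nonneg ht hs, x, hx, smul_smul _ _ _⟩

theorem zero_mem_stateCone (hF : F.Nonempty) : (0 : E × ℝ) ∈ stateCone F :=
  ⟨0, le_rfl, hF.some, hF.some_mem, (zero_smul _ _).symm⟩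

theorem stateCone_mono {G : Set E} (h : F ⊆ G) : stateCone F ⊆ stateCone G := by
  rintro _ ⟨t, ht, x, hx, rfl⟩
  exact ⟨t, ht, x, h hx, rfl⟩

theorem smul_add_smul_lift {t s : ℝ} (h : t + s ≠ 0) (x y : E) :
    t • ((x, 1) : E × ℝ) + s • (y, 1) =
      (t + s) • ((t / (t + s)) • x + (s / (t + s)) • y, 1) := by
  ext
  · simp only [Prod.smul_mk, Prod.mk_add_mk, smul_add, smul_smul]
    rw [mul_div_cancel₀ _ h, mul_div_cancel₀ _ h]
  · simp

theorem add_mem_stateCone (hF : Convex ℝ F) {v w : E × ℝ} (hv : v ∈ stateCone F)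
    (hw : w ∈ stateCone F) : v + w ∈ stateCone F := by
  obtain ⟨t, ht, x, hx, rfl⟩ := hv
  obtain ⟨s, hs, y, hy, rfl⟩ := hw
  rcases (add_nonneg ht hs).eq_or_lt with h | h
  · have ht0 : t = 0 := by linarith
    have hs0 : s = 0 := by linarith
    rw [ht0, hs0, zero_smul, zero_smul, add_zero]
    exact zero_mem_stateCone ⟨x, hx⟩
  · rw [smul_add_smul_lift h.ne']
    refine ⟨t + s, h.le, _, hF hx hy (by positivity) (by positivity) ?_, rfl⟩
    rw [← add_div, div_self h.ne']

theorem sum_mem_stateCone {ι : Type*} (hF : Convex ℝ F) (hne : F.Nonempty) (s : Finset ι) {v : ι → E × ℝ}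
    (hv : ∀ i ∈ s, v i ∈ stateCone F) : ∑ i ∈ s, v i ∈ stateCone F := by
  classical
  induction s using Finset.induction_on with
  | empty => simpa using zero_mem_stateCone hne
  | insert i s hi ih =>
    rw [Finset.sum_insert hi]
    exact add_mem_stateCone hF (hv i (Finset.mem_insert_self _ _))
      (ih fun j hj => hv j (Finset.mem_insert_of_mem hj))

theorem mem_of_smul_mem_stateCone {t : ℝ} (ht : 0 < t) {x : E}
    (h : t • ((x, 1) : E × ℝ) ∈ stateCone F) : x ∈ F := by
  obtain ⟨s, -, y, hy, h⟩ := h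
  have h2 : t = s := by simpa using congrArg Prod.snd h
  have h1 : t • x = s • y := by simpa using congrArg Prod.fst h
  rw [← h2] at h1
  rwa [smul_right_injective E ht.ne' h1]

/-- The cone over a face inherits extremality: whatever an element of it dominates in the cone of
`Ω` lies in it too. -/
theorem mem_stateCone_of_add_mem (hF : IsExtreme ℝ Ω F) {v w : E × ℝ} (hv : v ∈ stateCone Ω)
    (hw : w ∈ stateCone Ω) (h : v + w ∈ stateCone F) : v ∈ stateCone F := by
  have hne : F.Nonempty := by
    obtain ⟨_, _, x, hx, _⟩ := h
    exact ⟨x, hx⟩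
  obtain ⟨t, ht, x, hx, rfl⟩ := hv
  obtain ⟨s, hs, y, hy, rfl⟩ := hw
  rcases ht.eq_or_lt with rfl | ht
  · rw [zero_smul]
    exact zero_mem_stateCone hne
  rcases hs.eq_or_lt with rfl | hs
  · simpa using h
  have hts : 0 < t + s := add_pos ht hs
  rw [smul_add_smul_lift hts.ne'] at h
  refine smul_mem_stateCone (mem_stateCone ?_) ht.le
  refine hF.left_mem_of_mem_openSegment hx hy (mem_of_smul_mem_stateCone hts h)
    ⟨t / (t + s), s / (t + s), div_pos ht hts, div_pos hs hts, ?_, rfl⟩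
  rw [← add_div, div_self hts.ne']

/-- `v` dominates a positive multiple of each point of `F`, in the order given by the cone of
`F`. -/
def IsConeInterior (F : Set E) (v : E × ℝ) : Prop :=
  ∀ y ∈ F, ∃ ε : ℝ, 0 < ε ∧ v - ε • (y, 1) ∈ stateCone F

theorem IsConeInterior.mem (hF : Convex ℝ F) (hne : F.Nonempty) {v : E × ℝ}
    (hv : IsConeInterior F v) : v ∈ stateCone F := by
  obtain ⟨y, hy⟩ := hne
  obtain ⟨ε, hε, h⟩ := hv y hy
  simpa using add_mem_stateCone hF h (smul_mem_stateCone (mem_stateCone hy) hε.le)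

theorem IsConeInterior.exists_sub (hF : Convex ℝ F) {v w : E × ℝ} (hv : IsConeInterior F v)
    (hw : w ∈ stateCone F) : ∃ ε : ℝ, 0 < ε ∧ IsConeInterior F (v - ε • w) := by
  obtain ⟨t, ht, y, hy, rfl⟩ := hw
  rcases ht.eq_or_lt with rfl | ht
  · exact ⟨1, one_pos, by simpa using hv⟩
  obtain ⟨ε, hε, h⟩ := hv y hy
  refine ⟨ε / (2 * t), by positivity, fun z hz => ?_⟩
  obtain ⟨δ, hδ, h'⟩ := hv z hz
  refine ⟨δ / 2, by positivity, ?_⟩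
  -- Half the sum of the two given members of the cone is the required difference.
  have := smul_mem_stateCone (add_mem_stateCone hF h h') (t := 1 / 2) (by norm_num)
  convert this using 1
  rw [smul_smul, div_mul_eq_mul_div, mul_div_mul_right _ _ ht.ne']
  module

/-- The sum of a basis, chosen among the lifted points of `F`, works: subtracting a small multiple
of any point leaves nonnegative coefficients. -/
theorem exists_isConeInterior [FiniteDimensional ℝ E] (hF : Convex ℝ F) (hne : F.Nonempty) :
    ∃ v, IsConeInterior F v := by
  obtain ⟨b, hb, hspan, hlin⟩ := exists_linearIndependent ℝ ((fun x : E => ((x, 1) : E × ℝ)) '' F)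
  have := hlin.setFinite.fintype
  have hmem : ∀ i : b, (i : E × ℝ) ∈ stateCone F := fun i => by
    obtain ⟨x, hx, h⟩ := hb i.2
    rw [← h]
    exact mem_stateCone hx
  refine ⟨∑ i : b, (i : E × ℝ), fun y hy => ?_⟩
  have hy' : ((y, 1) : E × ℝ) ∈ Submodule.span ℝ (range ((↑) : b → E × ℝ)) := by
    rw [Subtype.range_coe, hspan]
    exact Submodule.subset_span ⟨y, hy, rfl⟩
  obtain ⟨a, ha⟩ := (Submodule.mem_span_range_iff_exists_fun ℝ).1 hy'
  have hS : 0 ≤ ∑ i, |a i| := Finset.sum_nonneg fun _ _ => abs_nonneg _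
  refine ⟨(1 + ∑ i, |a i|)⁻¹, by positivity, ?_⟩
  rw [← ha, Finset.smul_sum, ← Finset.sum_sub_distrib]
  refine sum_mem_stateCone hF hne _ fun i _ => ?_
  have h1 : (i : E × ℝ) - (1 + ∑ i, |a i|)⁻¹ • a i • (i : E × ℝ) =
      (1 - (1 + ∑ i, |a i|)⁻¹ * a i) • (i : E × ℝ) := by
    rw [sub_smul, one_smul, smul_smul]
  rw [h1]
  refine smul_mem_stateCone (hmem i) (sub_nonneg.2 ?_)
  rw [inv_mul_le_iff₀ (by positivity), mul_one]
  have := Finset.single_le_sum (fun i _ => abs_nonneg (a i)) (Finset.mem_univ i)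
  linarith [le_abs_self (a i)]

theorem IsConeInterior.frameSum (hF : Convex ℝ F) {ω : ι → E} {p : ι → ℝ}
    (hp : ∀ i, 0 < p i) (hω : ∀ i, ω i ∈ F)
    (hv : IsConeInterior F (∑ i, p i • ((ω i, 1) : E × ℝ))) : IsConeInterior F (frameSum ω) := by
  intro y hy
  obtain ⟨ε, hε, h⟩ := hv y hy
  have hP : 0 < 1 + ∑ i, p i := by
    have := Finset.sum_nonneg fun i (_ : i ∈ Finset.univ) => (hp i).le
    linarith
  refine ⟨(1 + ∑ i, p i)⁻¹ * ε, by positivity, ?_⟩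
  have h1 := add_mem_stateCone hF (smul_mem_stateCone h (inv_nonneg.2 hP.le))
    (sum_mem_stateCone hF ⟨y, hy⟩ Finset.univ fun i _ => smul_mem_stateCone (mem_stateCone (hω i))
      (t := 1 - (1 + ∑ i, p i)⁻¹ * p i) ?_)
  · convert h1 using 1
    simp only [SSS.frameSum, smul_sub, sub_smul, one_smul, Finset.sum_sub_distrib, Finset.smul_sum,
      smul_smul]
    abel
  · rw [sub_nonneg, inv_mul_le_iff₀ hP, mul_one]
    have := Finset.single_le_sum (fun i _ => (hp i).le) (Finset.mem_univ i)
    linarith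

theorem IsOrthoFrame.apply_le {ω : ι → E} (hω : IsOrthoFrame Ω B ω) {v : E × ℝ}
    (hv : v ∈ stateCone Ω) : B (frameSum ω) v ≤ v.2 := by
  obtain ⟨t, ht, x, hx, rfl⟩ := hv
  rw [map_smul, smul_eq_mul]
  simpa using mul_le_of_le_one_right ht (hω.le_one x hx)

theorem IsOrthoFrame.isFace_frameFace (hΩ : Convex ℝ Ω) {ω : ι → E} (hω : IsOrthoFrame Ω B ω) :
    IsFace Ω (frameFace Ω B ω) := by
  have hcomb : ∀ (x y : E) (a b : ℝ), a + b = 1 → B (frameSum ω) (a • x + b • y, 1) =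
      a * B (frameSum ω) (x, 1) + b * B (frameSum ω) (y, 1) := fun x y a b hab => by
    rw [← smul_eq_mul, ← smul_eq_mul, ← map_smul, ← map_smul, ← map_add]
    simp [hab]
  refine ⟨fun x hx y hy a b ha hb hab => ⟨hΩ hx.1 hy.1 ha hb hab, ?_⟩, fun _ h => h.1, ?_⟩
  · rw [hcomb x y a b hab, hx.2, hy.2, mul_one, mul_one, hab]
  · rintro x hx y hy _ hz ⟨a, b, ha, hb, hab, rfl⟩
    refine ⟨hx, (hω.le_one x hx).antisymm ?_⟩
    have h1 := hz.2
    rw [hcomb x y a b hab] at h1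
    by_contra! hlt
    have h2 := mul_lt_mul_of_pos_left hlt ha
    have h3 := mul_le_mul_of_nonneg_left (hω.le_one y hy) hb.le
    linarith

namespace FrameGeometry

variable [FiniteDimensional ℝ E] {r : ℕ} {γ : Fin r → E}

/-- Extremality puts the frame of a spectral decomposition of `v` in `F`. The frame sum is at most
the unit with equality at `v`, hence with equality at each point of which `v` dominates a positive
multiple, and these are all points of `F`. -/
theorem exists_frame_of_interior (H : FrameGeometry Ω B γ) (hF : IsFace Ω F) (hne : F.Nonempty)
    {v : E × ℝ} (hv : IsConeInterior F v) :
    ∃ (k : ℕ) (ω : Fin k → E) (p : Fin k → ℝ), IsFrame Ω ω ∧ (∀ i, 0 < p i) ∧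
      v = ∑ i, p i • ((ω i, 1) : E × ℝ) ∧ (∀ i, ω i ∈ F) ∧ F ⊆ frameFace Ω B ω := by
  have hvF := hv.mem hF.1 hne
  have hv2 : 0 < v.2 := by
    obtain ⟨y, hy⟩ := hne
    obtain ⟨ε, hε, s, hs, z, hz, h⟩ := hv y hy
    have := congrArg Prod.snd h
    simp only [Prod.snd_sub, Prod.smul_mk, smul_eq_mul, mul_one] at this
    linarith
  obtain ⟨t, ht, x, hx, rfl⟩ := hvF
  replace ht : 0 < t := by simpa using hv2
  obtain ⟨k, ω, q, hω, hq, hqx⟩ := H.spectral.exists_pos_decomposition (hF.2.1 hx)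
  have hωF : ∀ i, ω i ∈ F := fun i => by
    classical
    refine mem_of_smul_mem_stateCone (hq i) (mem_stateCone_of_add_mem hF.2
      (smul_mem_stateCone (mem_stateCone (hω.2.1 i)) (hq i).le)
      (w := ∑ j ∈ Finset.univ.erase i, q j • ((ω j, 1) : E × ℝ))
      (sum_mem_stateCone H.convex ⟨x, hF.2.1 hx⟩ _ fun j _ =>
        smul_mem_stateCone (mem_stateCone (hω.2.1 j)) (hq j).le) ?_)
    rw [Finset.add_sum_erase _ (fun j => q j • ((ω j, 1) : E × ℝ)) (Finset.mem_univ i), hqx]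
    exact mem_stateCone hx
  refine ⟨k, ω, fun i => t * q i, hω, fun i => mul_pos ht (hq i), ?_, hωF, fun y hy => ?_⟩
  · rw [← hqx, Finset.smul_sum]
    simp only [smul_smul]
  · have hO := H.isOrthoFrame hω
    refine ⟨hF.2.1 hy, (hO.le_one y (hF.2.1 hy)).antisymm ?_⟩
    obtain ⟨ε, hε, h⟩ := hv y hy
    have h1 := hO.apply_le (stateCone_mono hF.2.1 h)
    have h2 : B (frameSum ω) (x, 1) = 1 := by
      rw [← hqx]
      simp only [map_sum, map_smul, smul_eq_mul,
        H.form.frameSum_apply_self hO.extreme hO.orth, mul_one]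
      exact sum_weights_eq_one hqx
    rw [map_sub, map_smul, map_smul, h2] at h1
    simp only [smul_eq_mul, Prod.snd_sub, Prod.smul_mk, mul_one] at h1
    exact le_of_mul_le_mul_left (by linarith) hε

/-- An interior element of the cone of a frame face is diagonal for a frame with the same sum. -/
theorem exists_frame_frameSum_eq [Nonempty ι] (H : FrameGeometry Ω B γ) {η : ι → E}
    (hη : IsOrthoFrame Ω B η) {v : E × ℝ} (hv : IsConeInterior (frameFace Ω B η) v) :
    ∃ (k : ℕ) (ω : Fin k → E) (p : Fin k → ℝ), IsFrame Ω ω ∧ (∀ i, 0 < p i) ∧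
      v = ∑ i, p i • ((ω i, 1) : E × ℝ) ∧ (∀ i, ω i ∈ frameFace Ω B η) ∧
      frameSum ω = frameSum η := by
  obtain ⟨k, ω, p, hω, hp, hvp, hωF, hF⟩ := H.exists_frame_of_interior
    (hη.isFace_frameFace H.convex) ⟨_, hη.mem H.form (Classical.arbitrary ι)⟩ hv
  have hO := H.isOrthoFrame hω
  -- Each family lies in the face of the other, so the cardinalities agree, and then the sums do.
  have h1 := H.form.card_le_of_apply_eq_one hη.extreme hη.orth hO.extreme hO.orth
    fun j => (hωF j).2
  have h2 := H.form.card_le_of_apply_eq_one hO.extreme hO.orth hη.extreme hη.orth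
    fun j => (hF (hη.mem H.form j)).2
  exact ⟨k, ω, p, hω, hp, hvp, hωF, h1.2 (h1.1.antisymm h2.1)⟩

theorem isConeInterior_frameSum [Nonempty ι] (H : FrameGeometry Ω B γ) {η : ι → E}
    (hη : IsOrthoFrame Ω B η) : IsConeInterior (frameFace Ω B η) (frameSum η) := by
  have hface := (hη.isFace_frameFace H.convex).1
  obtain ⟨v, hv⟩ := exists_isConeInterior hface ⟨_, hη.mem H.form (Classical.arbitrary ι)⟩
  obtain ⟨k, ω, p, hω, hp, rfl, hωF, hsum⟩ := H.exists_frame_frameSum_eq hη hv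
  rw [← hsum]
  exact hv.frameSum hface hp hωF

/-- Each nonempty face is the face of a frame. -/
theorem exists_eq_frameFace (H : FrameGeometry Ω B γ) (hF : IsFace Ω F) (hne : F.Nonempty) :
    ∃ (k : ℕ) (ω : Fin k → E), IsFrame Ω ω ∧ F = frameFace Ω B ω := by
  obtain ⟨v, hv⟩ := exists_isConeInterior hF.1 hne
  obtain ⟨k, ω, p, hω, hp, rfl, hωF, hsub⟩ := H.exists_frame_of_interior hF hne hv
  have hO := H.isOrthoFrame hω
  have : Nonempty (Fin k) := ⟨⟨0, hω.pos⟩⟩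
  refine ⟨k, ω, hω, hsub.antisymm fun x hx => ?_⟩
  -- The frame sum lies in the cone of `F` and dominates a positive multiple of `x`, so `x` is in
  -- `F`.
  obtain ⟨ε, hε, h⟩ := H.isConeInterior_frameSum hO x hx
  refine mem_of_smul_mem_stateCone hε (mem_stateCone_of_add_mem hF.2
    (smul_mem_stateCone (mem_stateCone hx.1) hε.le) (stateCone_mono (fun _ h => h.1) h) ?_)
  rw [add_sub_cancel]
  exact (hv.frameSum hF.1 hp hωF).mem hF.1 hne

/-- The sum of a frame in the face of `η` is at most the sum of `η`. -/
theorem apply_frameSum_le [Nonempty ι] (H : FrameGeometry Ω B γ) {η : ι → E} {ζ : κ → E}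
    (hη : IsOrthoFrame Ω B η) (hζ : IsOrthoFrame Ω B ζ) (h : ∀ j, ζ j ∈ frameFace Ω B η) {x : E}
    (hx : x ∈ Ω) : B (frameSum ζ) (x, 1) ≤ B (frameSum η) (x, 1) := by
  have hface := (hη.isFace_frameFace H.convex).1
  have hne : (frameFace Ω B η).Nonempty := ⟨_, hη.mem H.form (Classical.arbitrary ι)⟩
  -- For small `ε` the sum of `η` minus `ε` times the sum of `ζ` is still interior, hence diagonal
  -- in a frame `ω` with the same sum as `η`. Its coefficients are at least `1 - ε`, so it dominates
  -- `1 - ε` times the sum of `η`.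
  obtain ⟨ε, hε, hv⟩ := (H.isConeInterior_frameSum hη).exists_sub hface
    (sum_mem_stateCone hface hne Finset.univ fun j _ => mem_stateCone (h j))
  obtain ⟨k, ω, p, hω, hp, hvp, hωF, hsum⟩ := H.exists_frame_frameSum_eq hη hv
  have hO := H.isOrthoFrame hω
  have hp' : ∀ i, p i = 1 - ε * B (frameSum ζ) (ω i, 1) := fun i => by
    have h1 := congrArg (fun w => B w (ω i, 1)) hvp
    simp only [map_sub, map_smul, map_sum, LinearMap.sub_apply, LinearMap.smul_apply,
      LinearMap.sum_apply, smul_eq_mul] at h1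
    rw [Finset.sum_eq_single i (fun j _ hj => by rw [hO.orth j i hj, mul_zero]) (by simp),
      H.form.self _ (hO.extreme i), mul_one, (hωF i).2, ← frameSum_apply] at h1
    exact h1.symm
  have h1 : B (frameSum η) (x, 1) - ε * B (frameSum ζ) (x, 1) =
      ∑ i, p i * B (ω i, 1) (x, 1) := by
    have h1 := congrArg (fun w => B w (x, 1)) hvp
    simp only [map_sub, map_smul, map_sum, LinearMap.sub_apply, LinearMap.smul_apply,
      LinearMap.sum_apply, smul_eq_mul] at h1
    rwa [← frameSum_apply ζ] at h1
  have h2 : ∑ i, (1 - ε) * B (ω i, 1) (x, 1) ≤ ∑ i, p i * B (ω i, 1) (x, 1) := by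
    refine Finset.sum_le_sum fun i _ => mul_le_mul_of_nonneg_right ?_
      (H.form.nonneg _ (hω.2.1 i) _ hx)
    rw [hp']
    have := mul_le_of_le_one_right hε.le (hζ.le_one _ (hω.2.1 i))
    linarith
  rw [← Finset.mul_sum, ← frameSum_apply, hsum] at h2
  refine le_of_mul_le_mul_left ?_ hε
  linarith

/-- A frame in the face of `η` is the image of a part of `η` under an automorphism that preserves
this face. -/
theorem exists_aut_frameFace [Nonempty ι] (H : FrameGeometry Ω B γ) {η : ι → E} {ζ : κ → E}
    (hη : IsOrthoFrame Ω B η) (hζ : IsOrthoFrame Ω B ζ) (h : ∀ j, ζ j ∈ frameFace Ω B η)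
    {f : κ → ι} (hf : Function.Injective f) :
    ∃ g : E ≃ᵃ[ℝ] E, IsAut Ω g ∧ (∀ j, g (η (f j)) = ζ j) ∧ frameSum (g ∘ η) = frameSum η ∧
      g '' frameFace Ω B η = frameFace Ω B η := by
  -- The complement `η'` is orthogonal to the whole face, so adjoining it to `ζ` again gives an
  -- orthogonal frame. An automorphism that fixes `η'` pointwise preserves the face of `η`.
  obtain ⟨m, η', hη', -, hone⟩ := H.exists_complement hη
  have hzero : ∀ x ∈ frameFace Ω B η, ∀ i, B (η' i, 1) (x, 1) = 0 := fun x hx => by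
    have h1 := hone x hx.1
    rw [hx.2, add_eq_left, frameSum_apply] at h1
    exact fun i => (Finset.sum_eq_zero_iff_of_nonneg fun i _ =>
      H.form.nonneg _ (extremePoints_subset (hη'.extreme (Sum.inr i))) _ hx.1).1 h1 i
        (Finset.mem_univ i)
  have h1 : IsOrthoFrame Ω B (Sum.elim ζ η') := by
    refine ⟨?_, ?_, fun x hx => ?_⟩
    · rintro (i | i)
      · exact hζ.extreme i
      · exact hη'.extreme (Sum.inr i)
    · rintro (i | i) (j | j) hij
      · exact hζ.orth i j fun h => hij (by rw [h])
      · rw [H.form.symm]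
        exact hzero _ (h i) j
      · exact hzero _ (h j) i
      · exact hη'.orth (Sum.inr i) (Sum.inr j) fun h => hij (by rw [Sum.inr.inj h])
    · rw [frameSum_sumElim, map_add, LinearMap.add_apply]
      have := H.apply_frameSum_le hη hζ h hx
      linarith [hone x hx]
  have h2 : IsOrthoFrame Ω B (Sum.elim (η ∘ f) η') := by
    have := hη'.comp H.form (f := Sum.map f id) (hf.sumMap Function.injective_id)
    rwa [Sum.elim_comp_map] at this
  obtain ⟨g, hg, hgη⟩ := H.exists_aut h2 h1
  have hgη' : ∀ i, g (η' i) = η' i := fun i => hgη (Sum.inr i)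
  have hO := hη.map H.form hg
  have hface : ∀ j, (g ∘ η) j ∈ frameFace Ω B η := fun j => by
    refine ⟨extremePoints_subset (hO.extreme j), ?_⟩
    have h3 := hone _ (extremePoints_subset (hO.extreme j))
    have h4 := H.form.frameSum_map hg η' (η j)
    rw [show g ∘ η' = η' from funext hgη'] at h4
    have h5 := hone _ (extremePoints_subset (hη.extreme j))
    rw [H.form.frameSum_apply_self hη.extreme hη.orth] at h5
    rw [Function.comp_apply] at h3 ⊢
    linarith
  have hsum := (H.form.card_le_of_apply_eq_one hη.extreme hη.orth hO.extreme hO.orth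
    fun j => (hface j).2).2 rfl
  refine ⟨g, hg, fun j => hgη (Sum.inl j), hsum, ?_⟩
  rw [H.form.image_frameFace hg, frameFace, hsum, frameFace]

end FrameGeometry
end SSS
end

/-! ### Maximal flags, regularity and rank -/

noncomputable section
namespace SSS

variable {E : Type*} [NormedAddCommGroup E] [NormedSpace ℝ E] {Ω F : Set E}
  {B : E × ℝ →ₗ[ℝ] E × ℝ →ₗ[ℝ] ℝ} {ι κ : Type*} [Fintype ι] [Fintype κ]

/-- The flag of the faces of the initial parts of a frame. -/
def frameFlag (Ω : Set E) (B : E × ℝ →ₗ[ℝ] E × ℝ →ₗ[ℝ] ℝ) {r : ℕ} (ω : Fin r → E) (i : Fin r) :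
    Set E :=
  frameFace Ω B (ω ∘ Fin.castLE (Nat.succ_le_of_lt i.2))

theorem isExposed_frameFace [FiniteDimensional ℝ E] {ω : ι → E} (hω : IsOrthoFrame Ω B ω) :
    IsExposed ℝ Ω (frameFace Ω B ω) := by
  rintro ⟨y, hy⟩
  let l : E →ₗ[ℝ] ℝ := B (frameSum ω) ∘ₗ LinearMap.inl ℝ E ℝ
  have hl : ∀ x, B (frameSum ω) (x, 1) = l x + B (frameSum ω) (0, 1) := fun x => by
    simp [l, ← map_add]
  refine ⟨LinearMap.toContinuousLinearMap l, ?_⟩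
  simp only [LinearMap.coe_toContinuousLinearMap']
  ext x
  constructor
  · rintro ⟨hx, hx1⟩
    refine ⟨hx, fun z hz => ?_⟩
    have := hω.le_one z hz
    rw [hl] at this hx1
    linarith
  · rintro ⟨hx, hmax⟩
    refine ⟨hx, (hω.le_one x hx).antisymm ?_⟩
    have h1 := hy.2
    rw [hl] at h1 ⊢
    linarith [hmax y hy.1]

theorem isCompact_frameFace [FiniteDimensional ℝ E] (hΩ : IsCompact Ω) (ω : ι → E) :
    IsCompact (frameFace Ω B ω) := by
  have h := (B (frameSum ω)).continuous_of_finiteDimensional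
  exact hΩ.inter_right (isClosed_eq (h.comp (Continuous.prodMk_left 1)) continuous_const)

theorem IsOrthoFrame.frameFace_comp_subset (hB : IsFrameForm Ω B) {ω : ι → E}
    (hω : IsOrthoFrame Ω B ω) {f : κ → ι} (hf : Function.Injective f) :
    frameFace Ω B (ω ∘ f) ⊆ frameFace Ω B ω := fun x hx =>
  ⟨hx.1, (hω.le_one x hx.1).antisymm (hx.2.symm.trans_le (hω.frameSum_comp_le hB hf hx.1))⟩

theorem IsOrthoFrame.isFlag_frameFlag [FiniteDimensional ℝ E] (hB : IsFrameForm Ω B) {r : ℕ}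
    {ω : Fin r → E} (hω : IsOrthoFrame Ω B ω) : IsFlag Ω (frameFlag Ω B ω) := by
  have hO : ∀ i : Fin r, IsOrthoFrame Ω B (ω ∘ Fin.castLE (Nat.succ_le_of_lt i.2)) :=
    fun i => hω.comp hB (Fin.castLE_injective _)
  refine ⟨fun i j hij => ⟨?_, fun hsub => ?_⟩, fun i => ⟨⟨_, (hO i).mem hB (Fin.last i)⟩,
    isExposed_frameFace (hO i)⟩⟩
  · exact (hO j).frameFace_comp_subset hB
      (f := Fin.castLE (Nat.succ_le_succ (Fin.lt_def.1 hij).le)) (Fin.castLE_injective _)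
  -- The inclusion is strict: the last vector of the longer part is orthogonal to the shorter part.
  · have h1 := (hsub ((hO j).mem hB (Fin.last j))).2
    rw [frameSum_apply, Finset.sum_eq_zero] at h1
    · exact zero_ne_one h1
    · intro a _
      refine hω.orth _ _ (Fin.ne_of_lt ?_)
      have h2 := a.2
      have h3 := Fin.lt_def.1 hij
      change (a : ℕ) < j
      omega

theorem IsFrameForm.image_frameFlag (hB : IsFrameForm Ω B) {r : ℕ} {ω η : Fin r → E}
    {g : E ≃ᵃ[ℝ] E} (hg : IsAut Ω g) (h : ∀ i, g (ω i) = η i) (i : Fin r) :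
    g '' frameFlag Ω B ω i = frameFlag Ω B η i := by
  rw [frameFlag, hB.image_frameFace hg, ← Function.comp_assoc, show g ∘ ω = η from funext h,
    frameFlag]

namespace FrameGeometry

variable [FiniteDimensional ℝ E] {r : ℕ} {γ : Fin r → E}

theorem frameFace_of_card (H : FrameGeometry Ω B γ) {ω : Fin r → E} (hω : IsFrame Ω ω) :
    frameFace Ω B ω = Ω :=
  Subset.antisymm (fun _ h => h.1) fun x hx => ⟨hx, by
    rw [H.frameSum_apply_of_card (H.isOrthoFrame hω) (Fintype.card_fin r), H.unit x hx]⟩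

/-- The faces of a flag below the face of `η` are faces of initial parts of one frame, which has
the same sum as `η`. -/
theorem exists_frame_of_flag (H : FrameGeometry Ω B γ) {m : ℕ} (Φ : Fin m → Set E)
    (hmono : Monotone Φ) (hΦ : ∀ i, IsFace Ω (Φ i) ∧ (Φ i).Nonempty) {k : ℕ} {η : Fin k → E}
    (hη : IsFrame Ω η) (hsub : ∀ i, Φ i ⊆ frameFace Ω B η) :
    ∃ ω : Fin k → E, IsFrame Ω ω ∧ frameSum ω = frameSum η ∧
      ∀ i, ∃ (j : ℕ) (h : j ≤ k), Φ i = frameFace Ω B (ω ∘ Fin.castLE h) := by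
  induction m generalizing k with
  | zero => exact ⟨η, hη, rfl, fun i => i.elim0⟩
  | succ m ih =>
    obtain ⟨l, ζ, hζ, hζΦ⟩ := H.exists_eq_frameFace (hΦ (Fin.last m)).1 (hΦ (Fin.last m)).2
    obtain ⟨ω, hω, hsum, hωΦ⟩ := ih (Φ ∘ Fin.castSucc)
      (hmono.comp Fin.strictMono_castSucc.monotone) (fun i => hΦ _) hζ
      fun i => hζΦ ▸ hmono (Fin.le_last _)
    have hO := H.isOrthoFrame hω
    have hηO := H.isOrthoFrame hη
    have hlast : Φ (Fin.last m) = frameFace Ω B ω := by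
      rw [hζΦ, frameFace, frameFace, hsum]
    have hωη : ∀ i, ω i ∈ frameFace Ω B η :=
      fun i => hsub (Fin.last m) (hlast ▸ hO.mem H.form i)
    have hlk : l ≤ k := by
      simpa using (H.form.card_le_of_apply_eq_one hηO.extreme hηO.orth hO.extreme hO.orth
        fun i => (hωη i).2).1
    have : Nonempty (Fin k) := ⟨⟨0, hη.pos⟩⟩
    -- Moving `η` inside its face makes its first `l` members equal to `ω`, the frame already
    -- adapted to the whole flag.
    obtain ⟨g, hg, hgω, hgη, -⟩ := H.exists_aut_frameFace hηO hO hωη (Fin.castLE_injective hlk)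
    have hgω' : (g ∘ η) ∘ Fin.castLE hlk = ω := funext hgω
    refine ⟨g ∘ η, (hηO.map H.form hg).isFrame H.form hη.pos, hgη, fun i => ?_⟩
    induction i using Fin.lastCases with
    | last => exact ⟨l, hlk, by rw [hgω', hlast]⟩
    | cast i =>
      obtain ⟨j, hj, h⟩ := hωΦ i
      refine ⟨j, hj.trans hlk, h.trans ?_⟩
      rw [← hgω']
      rfl

/-- Each flag is part of the flag of a maximal frame. -/
theorem exists_frameFlag (H : FrameGeometry Ω B γ) {m : ℕ} {Φ : Fin m → Set E}
    (hΦ : IsFlag Ω Φ) : ∃ (ω : Fin r → E) (s : Fin m → Fin r), IsFrame Ω ω ∧ StrictMono s ∧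
      Φ = frameFlag Ω B ω ∘ s := by
  obtain ⟨ω, hω, -, h⟩ := H.exists_frame_of_flag Φ hΦ.1.monotone
    (fun i => ⟨⟨(hΦ.2 i).2.convex H.convex, (hΦ.2 i).2.isExtreme⟩, (hΦ.2 i).1⟩) H.frame
    fun i => (H.frameFace_of_card H.frame).symm ▸ (hΦ.2 i).2.subset
  have hs : ∀ i, ∃ j : Fin r, Φ i = frameFlag Ω B ω j := fun i => by
    obtain ⟨j, hj, hij⟩ := h i
    -- Length `0` would give the empty face. Position `j` of `frameFlag` uses `j + 1` vectors.
    rcases j with - | j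
    · obtain ⟨x, hx⟩ := (hΦ.2 i).1
      rw [hij] at hx
      have := hx.2
      simp [frameSum] at this
    · exact ⟨⟨j, hj⟩, hij⟩
  choose s hs using hs
  refine ⟨ω, s, hω, fun i j hij => ?_, funext hs⟩
  have h1 := hΦ.1 hij
  rw [hs, hs] at h1
  exact ((H.isOrthoFrame hω).isFlag_frameFlag H.form).1.lt_iff_lt.1 h1

theorem isMaximalFlag_frameFlag (H : FrameGeometry Ω B γ) {ω : Fin r → E} (hω : IsFrame Ω ω) :
    IsMaximalFlag Ω (frameFlag Ω B ω) := by
  refine ⟨(H.isOrthoFrame hω).isFlag_frameFlag H.form, fun l Ψ hΨ ⟨s, hs, _⟩ => ?_⟩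
  obtain ⟨_, s', -, hs', -⟩ := H.exists_frameFlag hΨ
  have h1 := Fintype.card_le_of_injective s hs.injective
  have h2 := Fintype.card_le_of_injective s' hs'.injective
  simp only [Fintype.card_fin] at h1 h2
  exact h2.antisymm h1

theorem exists_eq_frameFlag (H : FrameGeometry Ω B γ) {m : ℕ} {Φ : Fin m → Set E}
    (hΦ : IsMaximalFlag Ω Φ) :
    ∃ (h : m = r) (ω : Fin r → E), IsFrame Ω ω ∧ ∀ i, Φ i = frameFlag Ω B ω (Fin.cast h i) := by
  obtain ⟨ω, s, hω, hs, rfl⟩ := H.exists_frameFlag hΦ.1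
  obtain rfl := hΦ.2 r _ ((H.isOrthoFrame hω).isFlag_frameFlag H.form) ⟨s, hs, rfl⟩
  refine ⟨rfl, ω, hω, fun i => ?_⟩
  rw [Function.comp_apply, hs.eq_id]
  rfl

theorem isRegular (H : FrameGeometry Ω B γ) : IsRegular Ω := by
  intro m l Φ Ψ hΦ hΨ
  obtain ⟨rfl, ω, hω, h1⟩ := H.exists_eq_frameFlag hΦ
  obtain ⟨rfl, η, hη, h2⟩ := H.exists_eq_frameFlag hΨ
  obtain ⟨g, hg, hgω⟩ := H.symmetric.exists_aut hω hη
  refine ⟨rfl, g, hg, fun i => ?_⟩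
  rw [h1, h2, H.form.image_frameFlag hg hgω]
  rfl

theorem isMaximalFrame (H : FrameGeometry Ω B γ) {ω : Fin r → E} (hω : IsFrame Ω ω) :
    IsMaximalFrame Ω ω := by
  refine ⟨hω, fun l η hη ⟨s, hs, _⟩ => ?_⟩
  have h1 := Fintype.card_le_of_injective s hs.injective
  have h2 := H.card_le (H.isOrthoFrame hη)
  simp only [Fintype.card_fin] at h1 h2
  exact h2.antisymm h1

/-- A frame that generates `Ω` has sum `1` on all of `Ω`, in particular on `γ`, so it has at least
`r` members. Conversely the sum of `γ` is interior in the cone of `Ω`, so a face containing `γ` is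
everything. -/
theorem hasRank (H : FrameGeometry Ω B γ) : HasRank Ω Ω r := by
  have hΩ : IsFace Ω Ω := ⟨H.convex, IsExtreme.rfl⟩
  refine fun k => ⟨fun ⟨ω, hω, h⟩ => ?_, ?_⟩
  · have hO := H.isOrthoFrame hω
    have hsub : Ω ⊆ frameFace Ω B ω := by
      conv_lhs => rw [← h]
      exact sInter_subset_of_mem ⟨hO.isFace_frameFace H.convex,
        range_subset_iff.2 fun i => hO.mem H.form i⟩
    have h1 := (H.form.card_le_of_apply_eq_one hO.extreme hO.orth H.frame.1
      (H.form.orth r γ H.frame) fun i => (hsub (H.frame.2.1 i)).2).1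
    have h2 := H.card_le hO
    simp only [Fintype.card_fin] at h1 h2
    exact h2.antisymm h1
  · rintro rfl
    refine ⟨γ, H.frame, Subset.antisymm
      (sInter_subset_of_mem ⟨hΩ, range_subset_iff.2 H.frame.2.1⟩) ?_⟩
    rintro x hx F ⟨hF, hγF⟩
    have : Nonempty (Fin k) := ⟨⟨0, H.frame.pos⟩⟩
    obtain ⟨ε, hε, h⟩ := H.isConeInterior_frameSum H.isOrthoFrame_unit x
      ((H.frameFace_of_card H.frame).symm ▸ hx)
    refine mem_of_smul_mem_stateCone hε (mem_stateCone_of_add_mem hF.2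
      (smul_mem_stateCone (mem_stateCone hx) hε.le) (stateCone_mono (fun _ h => h.1) h) ?_)
    rw [add_sub_cancel]
    exact sum_mem_stateCone hF.1 ⟨_, hγF (mem_range_self ⟨0, H.frame.pos⟩)⟩ _
      fun i _ => mem_stateCone (hγF (mem_range_self i))

/-! ### Barycenters of frame faces and the Farran–Robertson polytope -/

variable [MeasurableSpace E] [BorelSpace E]

/-- The barycenter of the face of a frame is the mean of the frame. -/
theorem card_smul_barycenter [Nonempty ι] (H : FrameGeometry Ω B γ) (hΩ : IsCompact Ω) {η : ι → E}
    (hη : IsOrthoFrame Ω B η) :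
    (Fintype.card ι : ℝ) • ((barycenter (frameFace Ω B η), 1) : E × ℝ) = frameSum η := by
  set F := frameFace Ω B η with hF
  have hface := hη.isFace_frameFace H.convex
  have hne : F.Nonempty := ⟨_, hη.mem H.form (Classical.arbitrary ι)⟩
  have hc : IsCompact F := isCompact_frameFace hΩ η
  have hbF : barycenter F ∈ F := barycenter_mem hc hface.1 hne
  set b := barycenter F with hb
  let i₀ : ι := Classical.arbitrary ι
  -- Extreme points in `F` are conjugate under automorphisms that preserve `F`, and these fix its
  -- barycenter.
  have hconst : ∀ x ∈ extremePoints ℝ Ω, x ∈ F → B (b, 1) (x, 1) = B (b, 1) (η i₀, 1) :=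
    fun x hx hxF => by
      obtain ⟨g, hg, hgx, -, hgF⟩ := H.exists_aut_frameFace hη
        (H.isOrthoFrame (isFrame_one hx)) (fun _ => hxF) (f := fun _ : Fin 1 => i₀)
        (Function.injective_of_subsingleton _)
      rw [← H.form.map g hg b (η i₀), hgx 0, hb, map_barycenter hc hface.1 hne hgF]
  obtain ⟨k, ω, p, hω, hp, hpb⟩ := H.spectral.exists_pos_decomposition hbF.1
  have hO := H.isOrthoFrame hω
  have hωF : ∀ i, ω i ∈ F := fun i => by
    refine ⟨hω.2.1 i, (hη.le_one _ (hω.2.1 i)).antisymm ?_⟩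
    by_contra! hlt
    have h1 : ∑ j, p j * B (frameSum η) (ω j, 1) < ∑ j, p j :=
      Finset.sum_lt_sum
        (fun j _ => mul_le_of_le_one_right (hp j).le (hη.le_one _ (hω.2.1 j)))
        ⟨i, Finset.mem_univ i, mul_lt_of_lt_one_right (hp i) hlt⟩
    have h2 := hbF.2
    rw [← hpb] at h2
    simp only [map_sum, map_smul, smul_eq_mul] at h2
    rw [h2, sum_weights_eq_one hpb] at h1
    exact lt_irrefl _ h1
  have hp' : ∀ i, p i = B (b, 1) (η i₀, 1) := fun i => by
    rw [← hconst _ (hO.extreme i) (hωF i), ← hpb]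
    simp only [map_sum, map_smul, LinearMap.sum_apply, LinearMap.smul_apply, smul_eq_mul]
    rw [Finset.sum_eq_single i (fun j _ hj => by rw [hO.orth j i hj, mul_zero]) (by simp),
      H.form.self _ (hO.extreme i), mul_one]
  have hpos : 0 < B (b, 1) (η i₀, 1) := hp' ⟨0, hω.pos⟩ ▸ hp _
  have hle := H.form.card_le_of_apply_eq_one hη.extreme hη.orth hO.extreme hO.orth
    fun i => (hωF i).2
  obtain ⟨f⟩ := Function.Embedding.nonempty_of_card_le hle.1
  obtain ⟨g, hg, hgω, hgη, hgF⟩ := H.exists_aut_frameFace hη hO hωF f.injective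
  have hgO := hη.map H.form hg
  -- A member of `g ∘ η` outside `ω` would be orthogonal to the barycenter, yet the common value in
  -- `hconst` is positive.
  have hsurj : Function.Surjective f := fun i => by
    by_contra! hi
    have h1 : B (b, 1) (g (η i), 1) = B (b, 1) (η i₀, 1) :=
      hconst _ (hgO.extreme i) (hgF.subset (mem_image_of_mem g (hη.mem H.form i)))
    rw [← hpb] at h1
    simp only [map_sum, map_smul, LinearMap.sum_apply, LinearMap.smul_apply, smul_eq_mul] at h1
    rw [Finset.sum_eq_zero fun j _ => ?_] at h1
    · rw [← hpb] at hpos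
      simp only [map_sum, map_smul, LinearMap.sum_apply, LinearMap.smul_apply, smul_eq_mul] at hpos
      exact hpos.ne h1
    · rw [← hgω j]
      exact mul_eq_zero_of_right _ (hgO.orth _ _ (hi j))
  have hcard : Fintype.card (Fin k) = Fintype.card ι :=
    Fintype.card_of_bijective ⟨f.injective, hsurj⟩
  have hsum := sum_weights_eq_one hpb
  simp only [hp', Finset.sum_const, nsmul_eq_mul, Finset.card_univ, hcard] at hsum
  rw [← hle.2 hcard, ← hpb]
  simp only [hp', ← Finset.smul_sum, smul_smul, hsum, one_smul]
  rfl

/-- The barycenters are the means of the initial parts of `ω`, so they and the `ω i` have the same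
affine span. -/
theorem farranRobertsonPolytope_frameFlag (H : FrameGeometry Ω B γ) (hΩ : IsCompact Ω)
    {ω : Fin r → E} (hω : IsFrame Ω ω) :
    farranRobertsonPolytope Ω (frameFlag Ω B ω) = convexHull ℝ (range ω) := by
  have hO := H.isOrthoFrame hω
  set c := barycenter Ω with hc
  have hb : ∀ i : Fin r, ((i + 1 : ℕ) : ℝ) • ((barycenter (frameFlag Ω B ω i), 1) : E × ℝ) =
      frameSum (ω ∘ Fin.castLE (Nat.succ_le_of_lt i.2)) := fun i => by
    have := H.card_smul_barycenter hΩ (hO.comp H.form (Fin.castLE_injective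
      (Nat.succ_le_of_lt i.2)))
    rwa [Fintype.card_fin] at this
  have hc' : (r : ℝ) • ((c, 1) : E × ℝ) = frameSum ω := by
    have : Nonempty (Fin r) := ⟨⟨0, hω.pos⟩⟩
    have := H.card_smul_barycenter hΩ hO
    rwa [Fintype.card_fin, H.frameFace_of_card hω] at this
  set S := Submodule.span ℝ (range fun i => barycenter (frameFlag Ω B ω i) - c) with hS
  have hpartial : ∀ (j : ℕ) (hj : j ≤ r),
      (frameSum (ω ∘ Fin.castLE hj)).1 - (j : ℝ) • c ∈ S := by
    rintro (- | j) hj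
    · simp [frameSum]
    · have h1 := congrArg Prod.fst (hb ⟨j, hj⟩)
      simp only [Prod.smul_fst] at h1
      rw [← h1, ← smul_sub]
      exact S.smul_mem _ (Submodule.subset_span ⟨⟨j, hj⟩, rfl⟩)
  have hmemS : ∀ i, ω i - c ∈ S := fun i => by
    -- Consecutive partial sums differ by the single vector `ω i`.
    have h1 := S.sub_mem (hpartial (i + 1) i.2) (hpartial i i.2.le)
    have h2 : frameSum (ω ∘ Fin.castLE (Nat.succ_le_of_lt i.2)) =
        frameSum (ω ∘ Fin.castLE i.2.le) + (ω i, 1) :=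
      Fin.sum_univ_castSucc _
    rw [h2] at h1
    convert h1 using 1
    simp only [Prod.fst_add, Nat.cast_add, Nat.cast_one, add_smul, one_smul]
    abel
  apply Subset.antisymm
  · rintro x ⟨hxS, hx⟩
    replace hxS : x - c ∈ S := hxS
    set W := Submodule.span ℝ (range fun i => ((ω i, 1) : E × ℝ)) with hW
    have hsumW : ∀ {j : ℕ} (f : Fin j → Fin r), frameSum (ω ∘ f) ∈ W := fun f =>
      Submodule.sum_mem _ fun i _ => Submodule.subset_span ⟨f i, rfl⟩
    have hcW : ((c, 1) : E × ℝ) ∈ W := by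
      refine (W.smul_mem_iff (Nat.cast_ne_zero.2 hω.pos.ne' : (r : ℝ) ≠ 0)).1 ?_
      rw [hc']
      exact hsumW id
    have hSW : S ≤ W.comap (LinearMap.inl ℝ E ℝ) := by
      rw [hS, Submodule.span_le]
      rintro _ ⟨i, rfl⟩
      have h1 : ((barycenter (frameFlag Ω B ω i), 1) : E × ℝ) ∈ W := by
        refine (W.smul_mem_iff (Nat.cast_ne_zero.2 (Nat.succ_ne_zero i) :
          ((i + 1 : ℕ) : ℝ) ≠ 0)).1 ?_
        rw [hb]
        exact hsumW _
      simpa using W.sub_mem h1 hcW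
    have hxW : ((x, 1) : E × ℝ) ∈ W := by
      simpa using W.add_mem (hSW hxS) hcW
    obtain ⟨a, ha⟩ := (Submodule.mem_span_range_iff_exists_fun ℝ).1 hxW
    refine mem_convexHull_of_exists_fintype a ω (fun i => ?_) (sum_weights_eq_one ha)
      (fun i => mem_range_self i) (by simpa [Prod.fst_sum] using congrArg Prod.fst ha)
    -- By orthonormality the coefficient `a i` is `B (x, 1) (ω i, 1)`.
    have h1 := H.form.nonneg x hx _ (hω.2.1 i)
    rw [← ha] at h1
    simp only [map_sum, map_smul, LinearMap.sum_apply, LinearMap.smul_apply, smul_eq_mul] at h1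
    rwa [Finset.sum_eq_single i (fun j _ hj => by rw [hO.orth j i hj, mul_zero]) (by simp),
      H.form.self _ (hO.extreme i), mul_one] at h1
  · refine convexHull_min (range_subset_iff.2 fun i => ⟨hmemS i, hω.2.1 i⟩)
      (Convex.inter (fun x hx y hy a b _ _ hab => ?_) H.convex)
    have h1 : a • x + b • y - c = a • (x - c) + b • (y - c) := by
      rw [smul_sub, smul_sub, sub_add_sub_comm, ← add_smul, hab, one_smul]
    change a • x + b • y - c ∈ S
    rw [h1]
    exact S.add_mem (S.smul_mem _ hx) (S.smul_mem _ hy)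

end FrameGeometry
end SSS
end
theorem mainTheorem4 {E : Type*} [NormedAddCommGroup E] [NormedSpace ℝ E] [FiniteDimensional ℝ E]
    [MeasurableSpace E] [BorelSpace E] (Ω : Set E) (hcompact : IsCompact Ω)
    (hconvex : Convex ℝ Ω) (hspan : affineSpan ℝ Ω = ⊤)
    (hspectral : SSS.IsSpectral Ω) (hsymm : SSS.IsStronglySymmetric Ω) :
    SSS.IsRegular Ω ∧
    (∃ (m : ℕ) (Φ : Fin m → Set E), SSS.IsMaximalFlag Ω Φ) ∧
    ∃ r : ℕ, SSS.HasRank Ω Ω r ∧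
      ∀ (m : ℕ) (Φ : Fin m → Set E), SSS.IsMaximalFlag Ω Φ →
        ∃ ω : Fin r → E, AffineIndependent ℝ ω ∧
          SSS.farranRobertsonPolytope Ω Φ = convexHull ℝ (Set.range ω) ∧
          SSS.IsMaximalFrame Ω ω := by
  have hint : (interior Ω).Nonempty := hconvex.interior_nonempty_iff_affineSpan_eq_top.2 hspan
  have hne : Ω.Nonempty := hint.mono interior_subset
  have hfix : ∀ g : E ≃ᵃ[ℝ] E, SSS.IsAut Ω g → g (SSS.barycenter Ω) = SSS.barycenter Ω :=
    fun g hg => SSS.map_barycenter hcompact hconvex hne hg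
  have hmem := SSS.barycenter_mem hcompact hconvex hne
  obtain ⟨Q, hQs, hQp, hQi⟩ := SSS.exists_invariant_form hcompact hint hfix
  obtain ⟨B, hB⟩ := SSS.exists_frameForm hcompact hspectral hsymm hmem hQs hQp hQi
  obtain ⟨r, γ, H⟩ := SSS.exists_frameGeometry hconvex hB hspectral hsymm hmem hfix
  refine ⟨H.isRegular, ⟨r, _, H.isMaximalFlag_frameFlag H.frame⟩, r, H.hasRank, fun m Φ hΦ => ?_⟩
  obtain ⟨rfl, ω, hω, h⟩ := H.exists_eq_frameFlag hΦ
  obtain rfl : Φ = SSS.frameFlag Ω B ω := funext h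
  exact ⟨ω, hω.affineIndependent, H.farranRobertsonPolytope_frameFlag hcompact hω,
    H.isMaximalFrame hω⟩
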